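/- Let $\Omega\subset\mathbb R^2$ be a bounded connected open polygonal domain and let $\Theta\ge 1$. **DDFV meshes.** The primal mesh consists of a finite partition $\mathfrak M$ of $\Omega$ into connected open polygons $K$ with centers $x_K\in K$, and of the set $\partial\mathfrak M$ of boundary edges, regarded as degenerate cells whose center is the midpoint of the edge. Distinct edges meet at most at endpoints, and $\partial K\cap\partial L$ is exactly the edge $\sigma=K|L$ for neighbouring $K,L\in\mathfrak M$. For an edge $\sigma$ let $x_{K^*},x_{L^*}$ be its endpoints and $x_K,x_L$ the centers of the two primal cells on its two sides ($L=\sigma\in\partial\mathfrak M$ if $\sigma\subset\partial\Omega$), and put $\sigma^*=[x_K,x_L]$. The diamond $\mathcal D=\mathcal D_{\sigma,\sigma^*}$ is the open quadrilateral with crossing diagonals $\sigma,\sigma^*$, or, for $\sigma\subset\partial\Omega$, the open triangle with base $\sigma$ and apex $x_K$. Diamonds are nondegenerate. To each vertex $x_{K^*}$ of the primal mesh is attached the dual cell $K^*$: the open polygon obtained by connecting consecutive centers of the primal cells having $x_{K^*}$ as a vertex (including, if $x_{K^*}\in\partial\Omega$, the midpoints of the two adjacent boundary edges), i.e. the interior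 of the union of the triangles with apex $x_{K^*}$ and base $\sigma^*$ over all edges $\sigma$ ending at $x_{K^*}$. Its boundary consists of these $\sigma^*$ and, if $x_{K^*}\in\partial\Omega$, of the adjacent halves of the boundary edges. The set of dual cells with $x_{K^*}\in\Omega$ is $\mathfrak M^*$, the set of all dual cells is $\overline{\mathfrak M^*}$. The diamonds form a partition $\mathfrak D$ of $\Omega$, and so do the dual cells. **Notation and regularity.** Let $m$ denote lengths of segments and areas of open sets: $m_\sigma,m_{\sigma^*},m_K,m_{K^*},m_{\mathcal D}$; let $\alpha_{\mathcal D}$ be the angle between $x_L-x_K$ and $x_{L^*}-x_{K^*}$. The mesh has regularity $\Theta$ if $\theta_{\mathcal D}\le\Theta$ and $\tilde\theta_{\mathcal D}\le\Theta$ for all $\mathcal D\in\mathfrak D$, where $$\theta_{\mathcal D}=\frac1{2\sin\alpha_{\mathcal D}}\Big(\frac{m_\sigma}{m_{\sigma^*}}+\frac{m_{\sigma^*}}{m_\sigma}\Big),\qquad \tilde\theta_{\mathcal D}=\max\Big(\max_{K\in\mathfrak M,\ m_{\mathcal D\cap K}>0}\frac{m_{\mathcal D}}{m_{\mathcal D\cap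 K}}\,;\ \max_{K^*\in\mathfrak M^*,\ m_{\mathcal D\cap K^*}>0}\frac{m_{\mathcal D}}{m_{\mathcal D\cap K^*}}\Big).$$ A discrete field $u_{\mathcal T}$ assigns a real number to each cell of $\mathfrak M\cup\partial\mathfrak M$ and of $\overline{\mathfrak M^*}$. Operations on discrete fields are componentwise, $\mathbf 1_{\mathcal T}$ is the constant field $1$, $$[\![u_{\mathcal T},w_{\mathcal T}]\!]=\frac12\Big(\sum_{K\in\mathfrak M}m_Ku_Kw_K+\sum_{K^*\in\overline{\mathfrak M^*}}m_{K^*}u_{K^*}w_{K^*}\Big),$$ $$\nabla^{\mathcal D}u_{\mathcal T}=\frac1{\sin\alpha_{\mathcal D}}\Big(\frac{u_L-u_K}{m_{\sigma^*}}\,n_{\sigma K}+\frac{u_{L^*}-u_{K^*}}{m_\sigma}\,n_{\sigma^*K^*}\Big),$$ where $n_{\sigma K}$ is the unit normal to $\sigma$ pointing from $K$ to $L$ and $n_{\sigma^*K^*}$ the unit normal to $\sigma^*$ pointing from $K^*$ to $L^*$. **Proposition.** There is a constant $C>0$ depending only on $\Omega$ and $\Theta$ such that the following holds for every DDFV mesh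 of $\Omega$ with regularity $\Theta$. Let $v_{\mathcal T}$ and $v^\infty_{\mathcal T}$ be discrete fields with $v_K,v_K^\infty>0$ for all $K\in\mathfrak M$ and $v_{K^*},v^\infty_{K^*}>0$ for all $K^*\in\overline{\mathfrak M^*}$, and $$\sum_{K\in\mathfrak M}m_Kv_K=\sum_{K\in\mathfrak M}m_Kv_K^\infty=\sum_{K^*\in\overline{\mathfrak M^*}}m_{K^*}v_{K^*}=\sum_{K^*\in\overline{\mathfrak M^*}}m_{K^*}v_{K^*}^\infty=:M^1 .$$ Put $M^\infty=\max\big(\max_{K\in\mathfrak M}v_K^\infty,\ \max_{K^*\in\overline{\mathfrak M^*}}v_{K^*}^\infty\big)$. Then $$\Big[\!\!\Big[v_{\mathcal T}\log\frac{v_{\mathcal T}}{v_{\mathcal T}^\infty},\mathbf 1_{\mathcal T}\Big]\!\!\Big]\le C\,(M^1M^\infty)^{1/2}\sum_{\mathcal D\in\mathfrak D}m_{\mathcal D}\,\Big|\nabla^{\mathcal D}\sqrt{v_{\mathcal T}/v_{\mathcal T}^\infty}\Big|^2 .$$ The values of $v_{\mathcal T},v_{\mathcal T}^\infty$ on $\partial\mathfrak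 M$ are unrestricted: they enter only through $\sqrt{v_L/v_L^\infty}$, $L\in\partial\mathfrak M$, on the right-hand side, with the convention that this is $0$ where $v_L/v_L^\infty$ is negative or undefined. -/

import Mathlib

open MeasureTheory

noncomputable section

namespace DDFV

/-- The Euclidean plane. -/
abbrev Plane : Type := EuclideanSpace ℝ (Fin 2)

/-- A polygonal domain: a nonempty connected bounded open set which is the interior of a finite
union of nondegenerate closed triangles. -/
structure IsPolygonalDomain (Ω : Set Plane) : Prop where
  isOpen : IsOpen Ω
  isConnected : IsConnected Ω
  isBounded : Bornology.IsBounded Ω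
  polygonal : ∃ T : Finset (Fin 3 → Plane), (∀ t ∈ T, AffineIndependent ℝ t) ∧
    Ω = interior (⋃ t ∈ T, convexHull ℝ (Set.range t))

/-- A partition of `Ω`, in the sense used for meshes: disjoint open subsets of `Ω` whose closures
cover the closure of `Ω`. -/
structure IsPartition (Ω : Set Plane) {ι : Type} (A : ι → Set Plane) : Prop where
  isOpen : ∀ i, IsOpen (A i)
  subset : ∀ i, A i ⊆ Ω
  disjoint : ∀ i j, i ≠ j → Disjoint (A i) (A j)
  cover : (⋃ i, closure (A i)) = closure Ω

/-- The unit vector orthogonal to `t` that points to the side of `d` (for `t`, `d` linearly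
independent): the normalised component of `d` orthogonal to `t`. -/
def unitNormal (t d : Plane) : Plane :=
  ‖d - (inner ℝ t d / inner ℝ t t) • t‖⁻¹ • (d - (inner ℝ t d / inner ℝ t t) • t)

/-- The data of a DDFV mesh. `Cell` indexes the interior primal mesh `𝔐`, `Vertex` the vertices of
the primal mesh, that is the dual mesh `𝔐* ∪ ∂𝔐*`. Edges of the primal mesh are interior edges
`K|L` or boundary edges; the latter also index the degenerate primal cells `∂𝔐`. Each edge `σ`
carries one diamond, so edges index the diamond mesh too. -/
structure MeshData where
  Cell : Type
  Vertex : Type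
  IntEdge : Type
  BdryEdge : Type
  [fintypeCell : Fintype Cell]
  [fintypeVertex : Fintype Vertex]
  [fintypeIntEdge : Fintype IntEdge]
  [fintypeBdryEdge : Fintype BdryEdge]
  /-- the open polygonal control volume `K` -/
  cell : Cell → Set Plane
  /-- the center `x_K` -/
  center : Cell → Plane
  /-- the position `x_{K*}` of a vertex -/
  pt : Vertex → Plane
  /-- the first endpoint `K*` of an edge -/
  vtxA : IntEdge ⊕ BdryEdge → Vertex
  /-- the second endpoint `L*` of an edge -/
  vtxB : IntEdge ⊕ BdryEdge → Vertex
  /-- the primal cell `K` on one side of an edge -/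
  near : IntEdge ⊕ BdryEdge → Cell
  /-- the primal cell `L` on the other side of an interior edge -/
  far : IntEdge → Cell

attribute [instance] MeshData.fintypeCell MeshData.fintypeVertex MeshData.fintypeIntEdge
  MeshData.fintypeBdryEdge

namespace MeshData

variable (M : MeshData)

/-- Edges of the primal mesh; equivalently dual edges, or diamonds. -/
abbrev Edge : Type := M.IntEdge ⊕ M.BdryEdge

/-- The whole primal mesh `𝔐 ∪ ∂𝔐`. -/
abbrev PrimalCell : Type := M.Cell ⊕ M.BdryEdge

/-- Index set of the discrete unknowns: all primal cells and all dual cells. A discrete scalar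
field `u_𝒯` is a function `M.Index → ℝ`. -/
abbrev Index : Type := M.PrimalCell ⊕ M.Vertex

/-- The center of a primal cell; for a degenerate cell it is the midpoint of the edge. -/
def primalCenter : M.PrimalCell → Plane
  | .inl K => M.center K
  | .inr e => midpoint ℝ (M.pt (M.vtxA (.inr e))) (M.pt (M.vtxB (.inr e)))

/-- The primal cell `L` of `𝔐 ∪ ∂𝔐` opposite to `K = near σ`. -/
def opp : M.Edge → M.PrimalCell
  | .inl e => .inl (M.far e)
  | .inr e => .inr e

/-- `x_{K*}` -/
def xA (σ : M.Edge) : Plane := M.pt (M.vtxA σ)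

/-- `x_{L*}` -/
def xB (σ : M.Edge) : Plane := M.pt (M.vtxB σ)

/-- `x_K` -/
def xK (σ : M.Edge) : Plane := M.center (M.near σ)

/-- `x_L` -/
def xL (σ : M.Edge) : Plane := M.primalCenter (M.opp σ)

/-- The edge `σ` as a closed segment. -/
def edgeSeg (σ : M.Edge) : Set Plane := segment ℝ (M.xA σ) (M.xB σ)

/-- The dual edge `σ*` as a closed segment. -/
def dualSeg (σ : M.Edge) : Set Plane := segment ℝ (M.xK σ) (M.xL σ)

/-- `σ` is an edge of the primal cell `K`. -/
def IsEdgeOf (σ : M.Edge) (K : M.Cell) : Prop := M.near σ = K ∨ M.opp σ = .inl K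

/-- `a` is an endpoint of the edge `σ`; equivalently `σ*` is an edge of the dual cell `a`. -/
def IsEndOf (a : M.Vertex) (σ : M.Edge) : Prop := M.vtxA σ = a ∨ M.vtxB σ = a

/-- The diamond with diagonals `σ` and `σ*` (a triangle if `σ` lies on the boundary). -/
def diamond (σ : M.Edge) : Set Plane :=
  interior (convexHull ℝ {M.xK σ, M.xL σ, M.xA σ, M.xB σ})

/-- The dual cell of a vertex `a`: the polygon obtained by connecting consecutive centers of the
primal cells that have `a` as a vertex (together with the midpoints of the boundary edges ending
at `a`), i.e. the union of the triangles with apex `a` and base `σ*`. -/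
def dualCell (a : M.Vertex) : Set Plane :=
  interior (⋃ σ ∈ {σ : M.Edge | M.IsEndOf a σ}, convexHull ℝ {M.pt a, M.xK σ, M.xL σ})

/-- `M` is a DDFV mesh of `Ω`. -/
structure IsMesh (Ω : Set Plane) : Prop where
  /-- the interior primal cells form a partition of `Ω` -/
  primal_partition : IsPartition Ω M.cell
  cell_connected : ∀ K, IsConnected (M.cell K)
  center_mem : ∀ K, M.center K ∈ M.cell K
  /-- each primal cell is a polygon, bounded by its edges -/
  frontier_cell : ∀ K, frontier (M.cell K) = ⋃ σ ∈ {σ : M.Edge | M.IsEdgeOf σ K}, M.edgeSeg σ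
  pt_injective : Function.Injective M.pt
  exists_edge : ∀ a, ∃ σ, M.IsEndOf a σ
  /-- distinct edges meet at most at endpoints -/
  edge_disjoint : ∀ σ σ', σ ≠ σ' →
    Disjoint (openSegment ℝ (M.xA σ) (M.xB σ)) (M.edgeSeg σ')
  boundary_edge : ∀ e, M.edgeSeg (.inr e) ⊆ frontier Ω
  far_ne_near : ∀ e, M.far e ≠ M.near (.inl e)
  /-- the common boundary of two neighbouring cells is the edge between them -/
  interface : ∀ e, frontier (M.cell (M.near (.inl e))) ∩ frontier (M.cell (M.far e)) =
    M.edgeSeg (.inl e)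
  /-- diamonds are not flat -/
  nondegenerate : ∀ σ, AffineIndependent ℝ ![M.xA σ, M.xB σ, M.xK σ]
  /-- `σ` and `σ*` are the diagonals of the (quadrilateral) interior diamonds -/
  diagonals_cross : ∀ e : M.IntEdge,
    (openSegment ℝ (M.xA (.inl e)) (M.xB (.inl e)) ∩
      openSegment ℝ (M.xK (.inl e)) (M.xL (.inl e))).Nonempty
  /-- the diamonds form a partition of `Ω` -/
  diamond_partition : IsPartition Ω M.diamond
  /-- the dual cells form a partition of `Ω` -/
  dual_partition : IsPartition Ω M.dualCell
  /-- each dual cell is a polygon, bounded by its dual edges and, for a boundary vertex, by the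
  adjacent halves of the boundary edges ending there -/
  frontier_dualCell : ∀ a, frontier (M.dualCell a) =
    (⋃ σ ∈ {σ : M.Edge | M.IsEndOf a σ}, M.dualSeg σ) ∪
    ⋃ e ∈ {e : M.BdryEdge | M.IsEndOf a (.inr e)}, segment ℝ (M.pt a) (M.xL (.inr e))

/-- Length `m_σ` of the edge. -/
def mEdge (σ : M.Edge) : ℝ := dist (M.xA σ) (M.xB σ)

/-- Length `m_{σ*}` of the dual edge. -/
def mDualEdge (σ : M.Edge) : ℝ := dist (M.xK σ) (M.xL σ)

/-- Area `m_K` of an interior primal cell. -/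
def mCell (K : M.Cell) : ℝ := volume.real (M.cell K)

/-- Area `m_{K*}` of a dual cell. -/
def mDual (a : M.Vertex) : ℝ := volume.real (M.dualCell a)

/-- Area `m_D` of a diamond. -/
def mDiamond (σ : M.Edge) : ℝ := volume.real (M.diamond σ)

/-- `sin α_D`, with `α_D` the angle between `(x_K, x_L)` and `(x_{K*}, x_{L*})`. -/
def sinAngle (σ : M.Edge) : ℝ :=
  Real.sin (InnerProductGeometry.angle (M.xL σ - M.xK σ) (M.xB σ - M.xA σ))

/-- The local regularity factor `θ_D`. -/
def theta (σ : M.Edge) : ℝ :=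
  1 / (2 * M.sinAngle σ) * (M.mEdge σ / M.mDualEdge σ + M.mDualEdge σ / M.mEdge σ)

/-- The local regularity factor `θ̃_D`: the largest ratio `m_D / m_{D ∩ K}` or `m_D / m_{D ∩ K*}`,
for `K ∈ 𝔐` and `K* ∈ 𝔐*` (interior vertices) meeting `D` in positive measure. -/
def thetaTilde (Ω : Set Plane) (σ : M.Edge) : ℝ :=
  max
    (⨆ K : {K : M.Cell // 0 < volume.real (M.diamond σ ∩ M.cell K)},
      M.mDiamond σ / volume.real (M.diamond σ ∩ M.cell K))
    (⨆ a : {a : M.Vertex // M.pt a ∈ Ω ∧ 0 < volume.real (M.diamond σ ∩ M.dualCell a)},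
      M.mDiamond σ / volume.real (M.diamond σ ∩ M.dualCell a))

/-- Mesh regularity with parameter `Θ` (both factors are automatically at least `1`). -/
def IsRegular (Ω : Set Plane) (Θ : ℝ) : Prop :=
  ∀ σ, M.theta σ ≤ Θ ∧ M.thetaTilde Ω σ ≤ Θ

/-- `∑_{K ∈ 𝔐} m_K u_K`. -/
def primalMass (u : M.Index → ℝ) : ℝ := ∑ K, M.mCell K * u (.inl (.inl K))

/-- `∑_{K* ∈ 𝔐* ∪ ∂𝔐*} m_{K*} u_{K*}`. -/
def dualMass (u : M.Index → ℝ) : ℝ := ∑ a, M.mDual a * u (.inr a)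

/-- The bilinear form `⟦u, w⟧_𝒯`. The degenerate primal cells do not contribute. -/
def pairing (u w : M.Index → ℝ) : ℝ :=
  1 / 2 * (∑ K, M.mCell K * u (.inl (.inl K)) * w (.inl (.inl K)) +
    ∑ a, M.mDual a * u (.inr a) * w (.inr a))

/-- The discrete gradient on the diamond of `σ`. -/
def grad (u : M.Index → ℝ) (σ : M.Edge) : Plane :=
  (1 / M.sinAngle σ) •
    (((u (.inl (M.opp σ)) - u (.inl (.inl (M.near σ)))) / M.mDualEdge σ) •
        unitNormal (M.xB σ - M.xA σ) (M.xL σ - M.xK σ) +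
      ((u (.inr (M.vtxB σ)) - u (.inr (M.vtxA σ))) / M.mEdge σ) •
        unitNormal (M.xL σ - M.xK σ) (M.xB σ - M.xA σ))

/-- The maximum of a discrete field over the interior primal cells and all dual cells. -/
def supValue (u : M.Index → ℝ) : ℝ :=
  max (⨆ K : M.Cell, u (.inl (.inl K))) (⨆ a : M.Vertex, u (.inr a))

end MeshData

end DDFV

end

/-!
The relative entropy is bounded separately on the primal and on the dual mesh, by the same argument:
an elementary entropy bound followed by a discrete Sobolev inequality for `g = √(v / v∞)`.

*Entropy.* Since `v` and `v∞` have the same mass, the integrand may be replaced by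
`v∞ (g² log g² - g² + 1)`, which is at most `v∞ (3 k² + 2 |k|³)` with `k = g - 1`. By Cauchy–Schwarz
and `‖k‖² ≤ 2 M¹` in `L²(v∞)`, the entropy is bounded by `6 (M¹)^(1/2) ‖k‖²` with the norm of
`L⁴(v∞)`. The masses also allow replacing `1` by any constant `c ≥ 0`, and `v∞ ≤ M^∞` leads to the
unweighted `L⁴` norm of `g - c` (`DDFV.sum_mul_log_le`).

*Sobolev inequality.* It remains to bound `‖g - c‖²` in `L⁴` by the Dirichlet energy for a suitable
`c`. The function `(g - c) |g - c|`, with `c` chosen to give it mean zero, is estimated in `L²` by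
its total variation, and the total variation by Cauchy–Schwarz over the diamonds
(`DDFV.exists_sqrt_sum_pow_four_le`, `DDFV.IsPolygonalDomain.exists_sobolev`). The only geometric
facts needed are that `m_σ m_{σ*}` is bounded by the area of the diamond, that the larger of the two
halves of the diamond lies in an adjacent cell, and that the jumps of `g` are components of its
discrete gradient. The small half of a diamond, which is not controlled for the dual cells at the
boundary, is handled by comparing the values on both sides.

*Embedding of `BV` in `L²`.* For piecewise constant functions on a parallelogram, a point is joined
to a fixed one by two L-shaped paths; the product of the two bounds for the difference of the values
separates the variables (`DDFV.exists_hasPoincare_para`). Along a path, the difference of two values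
is at most the sum of the jumps over the interfaces which are met
(`DDFV.ofReal_abs_sub_le_of_isPreconnected`). Up to a null set, a polygonal domain is a finite union
of parallelograms, which are linked by chains of overlapping parallelograms inside the connected
domain (`DDFV.IsPolygonalDomain.exists_hasPoincare`); no regularity of the boundary is used.
-/

noncomputable section

namespace DDFV

open Set

/-! ### Parallelograms in the plane -/

/-- The determinant of two plane vectors. -/
def cross (a b : Plane) : ℝ := a 0 * b 1 - a 1 * b 0

lemma cross_smul_left (r : ℝ) (a c : Plane) : cross (r • a) c = r * cross a c := by
  simp [cross]; ring

lemma cross_smul_right (r : ℝ) (a c : Plane) : cross a (r • c) = r * cross a c := by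
  simp [cross]; ring

lemma cross_sub_left (a b c : Plane) : cross (a - b) c = cross a c - cross b c := by
  simp [cross]; ring

lemma cross_sq_add_inner_sq (a b : Plane) :
    cross a b ^ 2 + inner ℝ a b ^ 2 = ‖a‖ ^ 2 * ‖b‖ ^ 2 := by
  simp [EuclideanSpace.norm_sq_eq, PiLp.inner_apply, cross, Fin.sum_univ_two]
  ring

lemma abs_cross_le (a b : Plane) : |cross a b| ≤ ‖a‖ * ‖b‖ := by
  apply abs_le_of_sq_le_sq _ (by positivity)
  rw [mul_pow, ← cross_sq_add_inner_sq]
  nlinarith [sq_nonneg (inner ℝ a b : ℝ)]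

lemma continuous_cross_left (c : Plane) : Continuous fun a => cross a c := by
  unfold cross; fun_prop

lemma continuous_cross_right (c : Plane) : Continuous fun a => cross c a := by
  unfold cross; fun_prop

/-- Cramer's rule in the plane. -/
lemma cross_smul_eq (e f y : Plane) : cross e f • y = cross y f • e + cross e y • f := by
  ext i
  fin_cases i <;> simp [cross] <;> ring

/-- The affine parametrisation `(s, t) ↦ x + s e + t f`. -/
def paraMap (x e f : Plane) (p : ℝ × ℝ) : Plane := x + p.1 • e + p.2 • f

/-- The open parallelogram with corner `x` and sides `e`, `f`. -/
def para (x e f : Plane) : Set Plane := paraMap x e f '' (Ioo 0 1 ×ˢ Ioo 0 1)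

lemma continuous_paraMap (x e f : Plane) : Continuous (paraMap x e f) := by
  unfold paraMap; fun_prop

/-- The first coordinate of a point in the affine frame `(x, e, f)`. -/
def coordE (x e f y : Plane) : ℝ := cross (y - x) f / cross e f

/-- The second coordinate of a point in the affine frame `(x, e, f)`. -/
def coordF (x e f y : Plane) : ℝ := cross e (y - x) / cross e f

lemma coordE_paraMap {x e f : Plane} (h : cross e f ≠ 0) (p : ℝ × ℝ) :
    coordE x e f (paraMap x e f p) = p.1 := by
  rw [coordE, div_eq_iff h]; simp [paraMap, cross]; ring

lemma coordF_paraMap {x e f : Plane} (h : cross e f ≠ 0) (p : ℝ × ℝ) :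
    coordF x e f (paraMap x e f p) = p.2 := by
  rw [coordF, div_eq_iff h]; simp [paraMap, cross]; ring

lemma paraMap_coord {x e f : Plane} (h : cross e f ≠ 0) (y : Plane) :
    paraMap x e f (coordE x e f y, coordF x e f y) = y := by
  have h1 := cross_smul_eq e f (y - x)
  have h2 : y - x = (cross e f)⁻¹ • (cross (y - x) f • e + cross e (y - x) • f) := by
    rw [← h1, smul_smul, inv_mul_cancel₀ h, one_smul]
  rw [smul_add, smul_smul, smul_smul] at h2
  simp only [paraMap, coordE, coordF, div_eq_inv_mul]
  rw [add_assoc, ← h2]; abel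

lemma continuous_coordE (x e f : Plane) : Continuous (coordE x e f) := by
  unfold coordE
  exact ((continuous_cross_left f).comp (continuous_id.sub continuous_const)).div_const _

lemma continuous_coordF (x e f : Plane) : Continuous (coordF x e f) := by
  unfold coordF
  exact ((continuous_cross_right e).comp (continuous_id.sub continuous_const)).div_const _

lemma mem_para_iff {x e f : Plane} (h : cross e f ≠ 0) (y : Plane) :
    y ∈ para x e f ↔ coordE x e f y ∈ Ioo (0 : ℝ) 1 ∧ coordF x e f y ∈ Ioo (0 : ℝ) 1 := by
  constructor
  · rintro ⟨p, hp, rfl⟩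
    rw [coordE_paraMap h, coordF_paraMap h]
    exact hp
  · intro hy
    exact ⟨_, hy, paraMap_coord h y⟩

lemma isOpen_para {x e f : Plane} (h : cross e f ≠ 0) : IsOpen (para x e f) := by
  have : para x e f = coordE x e f ⁻¹' Ioo 0 1 ∩ coordF x e f ⁻¹' Ioo 0 1 := by
    ext y; exact mem_para_iff h y
  rw [this]
  exact (isOpen_Ioo.preimage (continuous_coordE x e f)).inter
    (isOpen_Ioo.preimage (continuous_coordF x e f))

lemma convex_para (x e f : Plane) : Convex ℝ (para x e f) := by
  rintro _ ⟨p, hp, rfl⟩ _ ⟨q, hq, rfl⟩ a b ha hb hab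
  have hQ : Convex ℝ ((Ioo (0 : ℝ) 1) ×ˢ (Ioo (0 : ℝ) 1)) := (convex_Ioo 0 1).prod (convex_Ioo 0 1)
  refine ⟨a • p + b • q, hQ hp hq ha hb hab, ?_⟩
  have : x = a • x + b • x := by rw [← add_smul, hab, one_smul]
  simp only [paraMap, Prod.fst_add, Prod.snd_add, Prod.smul_fst, Prod.smul_snd, smul_eq_mul]
  nth_rw 1 [this]
  module

lemma image_closedSquare_subset (x e f : Plane) :
    paraMap x e f '' (Icc 0 1 ×ˢ Icc 0 1) ⊆ closure (para x e f) := by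
  have : (Icc (0 : ℝ) 1 ×ˢ Icc (0 : ℝ) 1) = closure (Ioo (0 : ℝ) 1 ×ˢ Ioo (0 : ℝ) 1) := by
    rw [closure_prod_eq, closure_Ioo (by norm_num)]
  rw [this]
  exact image_closure_subset_closure_image (continuous_paraMap x e f)

/-- The linear part of `paraMap`, as an endomorphism of the plane. -/
def paraLin (e f : Plane) : Plane →ₗ[ℝ] Plane where
  toFun y := y 0 • e + y 1 • f
  map_add' y z := by simp only [PiLp.add_apply]; module
  map_smul' r y := by simp only [PiLp.smul_apply, smul_eq_mul, RingHom.id_apply]; module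

lemma det_paraLin (e f : Plane) : LinearMap.det (paraLin e f) = cross e f := by
  rw [← LinearMap.det_toMatrix (EuclideanSpace.basisFun (Fin 2) ℝ).toBasis, Matrix.det_fin_two]
  simp [LinearMap.toMatrix_apply, paraLin, cross]
  ring

lemma volume_image_paraMap (x e f : Plane) (S : Set (ℝ × ℝ)) :
    volume (paraMap x e f '' S) = ENNReal.ofReal |cross e f| * volume S := by
  let ψ : Plane ≃ᵐ ℝ × ℝ :=
    (MeasurableEquiv.toLp 2 (Fin 2 → ℝ)).symm.trans MeasurableEquiv.finTwoArrow
  have hψ : MeasurePreserving ψ volume volume :=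
    (volume_preserving_finTwoArrow ℝ).comp
      (EuclideanSpace.volume_preserving_symm_measurableEquiv_toLp (Fin 2))
  have h1 : paraMap x e f '' S = (fun y => x + y) '' (paraLin e f '' (ψ ⁻¹' S)) := by
    rw [← image_comp, ← MeasurableEquiv.image_symm, ← image_comp]
    apply image_congr
    intro p _
    simp only [Function.comp_apply, paraMap, paraLin, LinearMap.coe_mk, AddHom.coe_mk, add_assoc]
    rfl
  rw [h1, image_add_left, measure_preimage_add, Measure.addHaar_image_linearMap, det_paraLin,
    hψ.measure_preimage_equiv]

lemma volume_para (x e f : Plane) : volume (para x e f) = ENNReal.ofReal |cross e f| := by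
  rw [para, volume_image_paraMap]
  simp [Measure.volume_eq_prod]

lemma abs_coordE_sub_le (x e f y z : Plane) :
    |coordE x e f y - coordE x e f z| ≤ ‖f‖ / |cross e f| * dist y z := by
  rw [coordE, coordE, ← sub_div, abs_div, div_mul_eq_mul_div, ← cross_sub_left,
    sub_sub_sub_cancel_right, dist_eq_norm, mul_comm ‖f‖]
  gcongr
  exact abs_cross_le _ _

lemma abs_coordF_sub_le (x e f y z : Plane) :
    |coordF x e f y - coordF x e f z| ≤ ‖e‖ / |cross e f| * dist y z := by
  have : cross e (y - x) - cross e (z - x) = cross e (y - z) := by simp [cross]; ring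
  rw [coordF, coordF, ← sub_div, abs_div, div_mul_eq_mul_div, this, dist_eq_norm]
  gcongr
  exact abs_cross_le _ _

lemma coordE_mem_uIcc {x e f a b z : Plane} (hz : z ∈ segment ℝ a b) :
    coordE x e f z ∈ uIcc (coordE x e f a) (coordE x e f b) := by
  obtain ⟨c, d, hc, hd, hcd, rfl⟩ := hz
  convert convex_uIcc (coordE x e f a) (coordE x e f b) left_mem_uIcc right_mem_uIcc hc hd hcd
    using 1
  obtain rfl : d = 1 - c := by linarith
  simp [coordE, cross]
  ring

lemma coordF_mem_uIcc {x e f a b z : Plane} (hz : z ∈ segment ℝ a b) :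
    coordF x e f z ∈ uIcc (coordF x e f a) (coordF x e f b) := by
  obtain ⟨c, d, hc, hd, hcd, rfl⟩ := hz
  convert convex_uIcc (coordF x e f a) (coordF x e f b) left_mem_uIcc right_mem_uIcc hc hd hcd
    using 1
  obtain rfl : d = 1 - c := by linarith
  simp [coordF, cross]
  ring

lemma volume_segment (a b : Plane) : volume (segment ℝ a b) = 0 := by
  refine measure_mono_null (t := (line[ℝ, a, b] : Set Plane)) ?_ ?_
  · intro z hz
    rw [← convexHull_pair] at hz
    exact convexHull_subset_affineSpan _ hz
  · apply Measure.addHaar_affineSubspace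
    intro h
    have h1 : Module.finrank ℝ (line[ℝ, a, b]).direction ≤ 1 := by
      have := finrank_vectorSpan_range_le ℝ ![a, b] (n := 1) (by simp)
      rwa [Matrix.range_cons, Matrix.range_cons, Matrix.range_empty, union_empty,
        ← direction_affineSpan] at this
    rw [h, AffineSubspace.direction_top, finrank_top, finrank_euclideanSpace_fin] at h1
    omega

/-! ### Piecewise constant functions and their total variation -/

/-- A finite partition `A` of `Ω` into open cells whose interfaces are covered, up to finitely many
points, by the segments `[a e, b e]`: away from these points, a common point of the closures of two
distinct cells lies on a segment whose two sides `l e`, `r e` are these two cells. -/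
structure IsInterface (Ω : Set Plane) {ι E : Type} (A : ι → Set Plane) (a b : E → Plane)
    (l r : E → ι) : Prop where
  partition : IsPartition Ω A
  null : volume (Ω \ ⋃ i, A i) = 0
  separated : ∃ F : Set Plane, F.Finite ∧ ∀ i j z, i ≠ j → z ∈ Ω → z ∉ F →
    z ∈ closure (A i) → z ∈ closure (A j) →
    ∃ e, z ∈ segment ℝ (a e) (b e) ∧ ((l e = i ∧ r e = j) ∨ (l e = j ∧ r e = i))

/-- The total variation of the piecewise constant function with values `u i`: the sum over the
interfaces of length times jump. -/
def totalVar {ι E : Type} [Fintype E] (a b : E → Plane) (l r : E → ι) (u : ι → ℝ) : ℝ :=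
  ∑ e, dist (a e) (b e) * |u (l e) - u (r e)|

lemma totalVar_nonneg {ι E : Type} [Fintype E] (a b : E → Plane) (l r : E → ι) (u : ι → ℝ) :
    0 ≤ totalVar a b l r u :=
  Finset.sum_nonneg fun _ _ => mul_nonneg dist_nonneg (abs_nonneg _)

open Classical in
/-- Along a connected set, two values differ at most by the sum of the jumps over the interfaces it
meets. Each level strictly between the two values separates the cells in two families; the connected
set meets the closures of both, hence an interface where the level is crossed. So the interval
between the two values is covered by the intervals between the values on the two sides of the
interfaces which are met. -/
lemma ofReal_abs_sub_le_of_isPreconnected {ι E : Type} [Finite ι] [Fintype E] {A : ι → Set Plane}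
    {a b : E → Plane} {l r : E → ι} {Γ : Set Plane} (hcover : Γ ⊆ ⋃ i, closure (A i))
    (hsep : ∀ i j z, i ≠ j → z ∈ Γ → z ∈ closure (A i) → z ∈ closure (A j) →
      ∃ e, z ∈ segment ℝ (a e) (b e) ∧ ((l e = i ∧ r e = j) ∨ (l e = j ∧ r e = i)))
    (hΓ : IsPreconnected Γ) {i j : ι} {p q : Plane} (hp : p ∈ Γ) (hpi : p ∈ closure (A i))
    (hq : q ∈ Γ) (hqj : q ∈ closure (A j)) (u : ι → ℝ) :
    ENNReal.ofReal |u i - u j| ≤ ∑ e, if (segment ℝ (a e) (b e) ∩ Γ).Nonempty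
      then ENNReal.ofReal |u (l e) - u (r e)| else 0 := by
  wlog hij : u i ≤ u j generalizing i j p q
  · rw [abs_sub_comm]
    exact this hq hqj hp hpi (le_of_not_ge hij)
  have key : Ico (u i) (u j) ⊆ ⋃ e : E, if (segment ℝ (a e) (b e) ∩ Γ).Nonempty
      then Ico (min (u (l e)) (u (r e))) (max (u (l e)) (u (r e))) else ∅ := by
    intro c hc
    obtain ⟨z, hzΓ, hz1, hz2⟩ := isPreconnected_closed_iff.1 hΓ
      (⋃ k ∈ {k | u k ≤ c}, closure (A k)) (⋃ k ∈ {k | c < u k}, closure (A k))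
      ((toFinite _).isClosed_biUnion fun _ _ => isClosed_closure)
      ((toFinite _).isClosed_biUnion fun _ _ => isClosed_closure)
      (by
        intro z hz
        obtain ⟨k, hk⟩ := mem_iUnion.1 (hcover hz)
        rcases le_or_gt (u k) c with h | h
        · exact Or.inl (mem_biUnion (show k ∈ {k | u k ≤ c} from h) hk)
        · exact Or.inr (mem_biUnion (show k ∈ {k | c < u k} from h) hk))
      ⟨p, hp, mem_biUnion (show i ∈ {k | u k ≤ c} from hc.1) hpi⟩
      ⟨q, hq, mem_biUnion (show j ∈ {k | c < u k} from hc.2) hqj⟩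
    simp only [mem_ofPred_eq, mem_iUnion, exists_prop] at hz1 hz2
    obtain ⟨k, hk, hzk⟩ := hz1
    obtain ⟨k', hk', hzk'⟩ := hz2
    have hne : k ≠ k' := by rintro rfl; exact absurd hk (not_le.2 hk')
    obtain ⟨e, he, hlr⟩ := hsep k k' z hne hzΓ hzk hzk'
    refine mem_iUnion.2 ⟨e, ?_⟩
    rw [if_pos ⟨z, he, hzΓ⟩]
    rcases hlr with ⟨h1, h2⟩ | ⟨h1, h2⟩ <;> rw [h1, h2]
    · exact ⟨(min_le_left _ _).trans hk, hk'.trans_le (le_max_right _ _)⟩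
    · exact ⟨(min_le_right _ _).trans hk, hk'.trans_le (le_max_left _ _)⟩
  calc ENNReal.ofReal |u i - u j| = volume (Ico (u i) (u j)) := by
        rw [Real.volume_Ico, abs_sub_comm, abs_of_nonneg (sub_nonneg.2 hij)]
    _ ≤ ∑ e, volume (if (segment ℝ (a e) (b e) ∩ Γ).Nonempty
          then Ico (min (u (l e)) (u (r e))) (max (u (l e)) (u (r e))) else ∅) :=
        (measure_mono key).trans (measure_iUnion_fintype_le _ _)
    _ ≤ _ := by
        refine Finset.sum_le_sum fun e _ => ?_
        split_ifs
        · rw [Real.volume_Ico, max_sub_min_eq_abs, abs_sub_comm]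
        · simp

/-- The jumps over the interfaces whose projections to the line by the coordinate `ξ` contain a
given value: a bound for the variation along the line `ξ = t`. -/
def lineVar {ι E : Type} [Fintype E] (a b : E → Plane) (l r : E → ι) (u : ι → ℝ) (ξ : Plane → ℝ)
    (t : ℝ) : ENNReal :=
  ∑ e, (uIcc (ξ (a e)) (ξ (b e))).indicator (fun _ => ENNReal.ofReal |u (l e) - u (r e)|) t

lemma measurable_lineVar {ι E : Type} [Fintype E] (a b : E → Plane) (l r : E → ι) (u : ι → ℝ)
    (ξ : Plane → ℝ) : Measurable (lineVar a b l r u ξ) :=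
  Finset.measurable_sum _ fun _ _ => measurable_const.indicator measurableSet_uIcc

lemma lintegral_lineVar_le {ι E : Type} [Fintype E] (a b : E → Plane) (l r : E → ι) (u : ι → ℝ)
    {ξ : Plane → ℝ} {L : ℝ} (hL : 0 ≤ L) (hξ : ∀ x y, |ξ x - ξ y| ≤ L * dist x y) (s : Set ℝ) :
    ∫⁻ t in s, lineVar a b l r u ξ t ≤ ENNReal.ofReal (L * totalVar a b l r u) := by
  refine (setLIntegral_le_lintegral _ _).trans ?_
  unfold lineVar totalVar
  rw [lintegral_finsetSum _ fun _ _ => measurable_const.indicator measurableSet_uIcc,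
    Finset.mul_sum, ENNReal.ofReal_sum_of_nonneg fun _ _ => by positivity]
  refine Finset.sum_le_sum fun e _ => ?_
  rw [lintegral_indicator_const measurableSet_uIcc, Real.volume_interval,
    ← ENNReal.ofReal_mul (abs_nonneg _)]
  apply ENNReal.ofReal_le_ofReal
  have := hξ (b e) (a e)
  rw [dist_comm] at this
  nlinarith [abs_nonneg (u (l e) - u (r e))]

/-! ### The Poincaré inequality on a parallelogram -/

/-- The set `U` satisfies, with constant `C`, the Poincaré inequality bounding the `L²` norm on `U`
by the total variation on `Ω`, uniformly for all piecewise constant functions on `Ω`. -/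
def HasPoincare (Ω U : Set Plane) (C : ℝ) : Prop :=
  ∀ {ι E : Type} [Fintype ι] [Fintype E] (A : ι → Set Plane) (a b : E → Plane) (l r : E → ι),
    IsInterface Ω A a b l r → ∀ u : ι → ℝ,
      ∃ c : ℝ, ∑ i, volume.real (A i ∩ U) * (u i - c) ^ 2 ≤ C * totalVar a b l r u ^ 2

lemma ofReal_abs_sub_le_lineVar {Ω : Set Plane} {x e f : Plane} (hef : cross e f ≠ 0)
    (hP : para x e f ⊆ Ω) {ι E : Type} [Finite ι] [Fintype E] {A : ι → Set Plane}
    {a b : E → Plane} {l r : E → ι} (hpart : IsPartition Ω A) {F : Set Plane}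
    (hF : ∀ i j z, i ≠ j → z ∈ Ω → z ∉ F → z ∈ closure (A i) → z ∈ closure (A j) →
      ∃ e, z ∈ segment ℝ (a e) (b e) ∧ ((l e = i ∧ r e = j) ∨ (l e = j ∧ r e = i)))
    {s t s' t' : ℝ} (hs : s ∈ Ioo (0 : ℝ) 1) (ht : t ∈ Ioo (0 : ℝ) 1) (hs' : s' ∈ Ioo (0 : ℝ) 1)
    (ht' : t' ∈ Ioo (0 : ℝ) 1) (htF : t ∉ coordF x e f '' F) (hsF : s' ∉ coordE x e f '' F)
    {i j : ι} (hi : paraMap x e f (s, t) ∈ closure (A i))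
    (hj : paraMap x e f (s', t') ∈ closure (A j)) (u : ι → ℝ) :
    ENNReal.ofReal |u i - u j| ≤
      lineVar a b l r u (coordF x e f) t + lineVar a b l r u (coordE x e f) s' := by
  classical
  -- the L-shaped path
  set S : Set (ℝ × ℝ) := uIcc s s' ×ˢ {t} ∪ {s'} ×ˢ uIcc t t' with hS
  have hSpre : IsPreconnected S :=
    IsPreconnected.union (s', t) ⟨right_mem_uIcc, rfl⟩ ⟨rfl, left_mem_uIcc⟩
      (isPreconnected_uIcc.prod isPreconnected_singleton)
      (isPreconnected_singleton.prod isPreconnected_uIcc)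
  have hSQ : S ⊆ Ioo 0 1 ×ˢ Ioo 0 1 := by
    rintro ⟨s₁, t₁⟩ (⟨h1, h2⟩ | ⟨h1, h2⟩)
    · obtain rfl : t₁ = t := h2
      exact ⟨ordConnected_Ioo.uIcc_subset hs hs' h1, ht⟩
    · obtain rfl : s₁ = s' := h1
      exact ⟨hs', ordConnected_Ioo.uIcc_subset ht ht' h2⟩
  have hSor : ∀ p ∈ S, p.2 = t ∨ p.1 = s' := by
    rintro p (⟨_, h⟩ | ⟨h, _⟩)
    · exact Or.inl h
    · exact Or.inr h
  have hΓΩ : paraMap x e f '' S ⊆ Ω := (image_mono hSQ).trans hP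
  have hΓF : ∀ z ∈ paraMap x e f '' S, z ∉ F := by
    rintro _ ⟨p, hp, rfl⟩ hz
    rcases hSor p hp with h | h
    · exact htF ⟨_, hz, by rw [coordF_paraMap hef, h]⟩
    · exact hsF ⟨_, hz, by rw [coordE_paraMap hef, h]⟩
  refine (ofReal_abs_sub_le_of_isPreconnected (a := a) (b := b) (l := l) (r := r)
    (Γ := paraMap x e f '' S) (by rw [hpart.cover]; exact hΓΩ.trans subset_closure)
    (fun i j z hij hz => hF i j z hij (hΓΩ hz) (hΓF z hz))
    (hSpre.image _ (continuous_paraMap x e f).continuousOn)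
    ⟨(s, t), Or.inl ⟨left_mem_uIcc, rfl⟩, rfl⟩ hi
    ⟨(s', t'), Or.inr ⟨rfl, right_mem_uIcc⟩, rfl⟩ hj u).trans ?_
  unfold lineVar
  rw [← Finset.sum_add_distrib]
  refine Finset.sum_le_sum fun n _ => ?_
  split_ifs with hn
  · obtain ⟨_, hz, p, hp, rfl⟩ := hn
    rcases hSor p hp with h | h
    · have := coordF_mem_uIcc (x := x) (e := e) (f := f) hz
      rw [coordF_paraMap hef, h] at this
      rw [indicator_of_mem this]
      exact le_self_add
    · have := coordE_mem_uIcc (x := x) (e := e) (f := f) hz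
      rw [coordE_paraMap hef, h] at this
      rw [indicator_of_mem this (fun _ => ENNReal.ofReal |u (l n) - u (r n)|)]
      exact le_add_self
  · exact zero_le

/-- Parallelograms satisfy the Poincaré inequality. The constant is the value at a point
`(s₀, t₀)` where the variations along the two lines through it are at most their averages. Any
point `(s, t)` is joined to it by two L-shaped paths; the product of the two bounds for the
difference of the values separates the variables `s` and `t`. -/
lemma exists_hasPoincare_para {Ω : Set Plane} {x e f : Plane} (hef : cross e f ≠ 0)
    (hP : para x e f ⊆ Ω) : ∃ C, HasPoincare Ω (para x e f) C := by
  set L₁ := ‖f‖ / |cross e f|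
  set L₂ := ‖e‖ / |cross e f|
  refine ⟨|cross e f| * (L₁ + L₂) ^ 2, ?_⟩
  intro ι E _ _ A a b l r hA u
  obtain ⟨F, hFfin, hF⟩ := hA.separated
  set μ : Measure ℝ := volume.restrict (Ioo 0 1) with hμ
  have : IsProbabilityMeasure μ := ⟨by simp [hμ]⟩
  set V := totalVar a b l r u with hV
  have hV0 : 0 ≤ V := totalVar_nonneg a b l r u
  have hL₁ : 0 ≤ L₁ := by positivity
  have hL₂ : 0 ≤ L₂ := by positivity
  set va := lineVar a b l r u (coordF x e f)
  set vb := lineVar a b l r u (coordE x e f)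
  have hva : Measurable va := measurable_lineVar a b l r u _
  have hvb : Measurable vb := measurable_lineVar a b l r u _
  have hIa : ∫⁻ t, va t ∂μ ≤ ENNReal.ofReal (L₂ * V) :=
    lintegral_lineVar_le a b l r u hL₂ (abs_coordF_sub_le x e f) _
  have hIb : ∫⁻ s, vb s ∂μ ≤ ENNReal.ofReal (L₁ * V) :=
    lintegral_lineVar_le a b l r u hL₁ (abs_coordE_sub_le x e f) _
  have hnull : ∀ ξ : Plane → ℝ, μ (ξ '' F ∪ (Ioo 0 1)ᶜ) = 0 := by
    intro ξ
    refine measure_union_null ?_ ?_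
    · exact le_antisymm ((Measure.restrict_le_self _).trans
        ((hFfin.image ξ).measure_zero volume).le) zero_le
    · rw [hμ, Measure.restrict_apply measurableSet_Ioo.compl]; simp
  obtain ⟨s₀, hs₀, hs₀b⟩ := exists_notMem_null_le_laverage (IsProbabilityMeasure.ne_zero μ)
    hvb.aemeasurable (hnull (coordE x e f))
  obtain ⟨t₀, ht₀, ht₀a⟩ := exists_notMem_null_le_laverage (IsProbabilityMeasure.ne_zero μ)
    hva.aemeasurable (hnull (coordF x e f))
  rw [laverage_eq_lintegral] at hs₀b ht₀a
  rw [mem_union, not_or, notMem_compl_iff] at hs₀ ht₀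
  obtain ⟨k, hk⟩ : ∃ k, paraMap x e f (s₀, t₀) ∈ closure (A k) := by
    rw [← mem_iUnion, hA.partition.cover]
    exact subset_closure (hP ⟨_, ⟨hs₀.2, ht₀.2⟩, rfl⟩)
  refine ⟨u k, ?_⟩
  set Q : Set (ℝ × ℝ) := Ioo 0 1 ×ˢ Ioo 0 1 with hQ
  set B : ι → Set (ℝ × ℝ) := fun i => Q ∩ paraMap x e f ⁻¹' (A i) with hB
  have hBm : ∀ i, MeasurableSet (B i) := fun i =>
    (measurableSet_Ioo.prod measurableSet_Ioo).inter
      ((hA.partition.isOpen i).preimage (continuous_paraMap x e f)).measurableSet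
  have hBd : Pairwise (Function.onFun Disjoint B) := by
    intro i j hij
    exact ((hA.partition.disjoint i j hij).preimage _).mono inter_subset_right inter_subset_right
  have hνeq : (volume : Measure (ℝ × ℝ)).restrict Q = μ.prod μ := by
    rw [Measure.volume_eq_prod, hQ, ← Measure.prod_restrict]
  have hae : ∀ᵐ p : ℝ × ℝ ∂(volume.restrict Q),
      p.1 ∉ coordE x e f '' F ∧ p.2 ∉ coordF x e f '' F := by
    rw [hνeq]
    have h1 : ∀ᵐ s ∂μ, s ∉ coordE x e f '' F :=
      measure_mono_null (by intro s hs; exact Or.inl (not_not.1 hs)) (hnull (coordE x e f))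
    have h2 : ∀ᵐ s ∂μ, s ∉ coordF x e f '' F :=
      measure_mono_null (by intro s hs; exact Or.inl (not_not.1 hs)) (hnull (coordF x e f))
    exact (Measure.quasiMeasurePreserving_fst.ae h1).and (Measure.quasiMeasurePreserving_snd.ae h2)
  have hmain : ∑ i, volume (B i) * ENNReal.ofReal ((u i - u k) ^ 2) ≤
      ENNReal.ofReal (((L₁ + L₂) * V) ^ 2) := by
    set IA := ∫⁻ t, va t ∂μ
    set IB := ∫⁻ s, vb s ∂μ
    calc ∑ i, volume (B i) * ENNReal.ofReal ((u i - u k) ^ 2)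
        = ∑ i, ∫⁻ _ in B i, ENNReal.ofReal ((u i - u k) ^ 2) := by
          simp [mul_comm]
      _ ≤ ∑ i, ∫⁻ p in B i, (vb p.1 + IA) * (va p.2 + IB) := by
          refine Finset.sum_le_sum fun i _ => ?_
          refine lintegral_mono_ae ?_
          filter_upwards [ae_restrict_of_ae_restrict_of_subset inter_subset_left hae,
            ae_restrict_mem (hBm i)] with p hp hpB
          have hpi : paraMap x e f (p.1, p.2) ∈ closure (A i) := subset_closure hpB.2
          have h1 := ofReal_abs_sub_le_lineVar hef hP hA.partition hF hpB.1.1 hpB.1.2 hs₀.2 ht₀.2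
            hp.2 hs₀.1 hpi hk u
          have h2 := ofReal_abs_sub_le_lineVar hef hP hA.partition hF hs₀.2 ht₀.2 hpB.1.1 hpB.1.2
            ht₀.1 hp.1 hk hpi u
          rw [← sq_abs, sq, ENNReal.ofReal_mul (abs_nonneg _)]
          refine mul_le_mul' ?_ (h1.trans (add_le_add le_rfl hs₀b))
          rw [abs_sub_comm, add_comm]
          exact h2.trans (add_le_add ht₀a le_rfl)
      _ = ∫⁻ p in ⋃ i, B i, (vb p.1 + IA) * (va p.2 + IB) := by
          rw [lintegral_iUnion hBm hBd, tsum_fintype]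
      _ ≤ ∫⁻ p in Q, (vb p.1 + IA) * (va p.2 + IB) :=
          lintegral_mono_set (iUnion_subset fun i => inter_subset_left)
      _ = (IB + IA) * (IA + IB) := by
          rw [hνeq, lintegral_prod_mul (f := fun s => vb s + IA) (g := fun t => va t + IB)
            (hvb.add_const _).aemeasurable (hva.add_const _).aemeasurable,
            lintegral_add_right _ measurable_const, lintegral_add_right _ measurable_const]
          simp [IA, IB]
      _ ≤ ENNReal.ofReal ((L₁ + L₂) * V) * ENNReal.ofReal ((L₁ + L₂) * V) := by
          have : ENNReal.ofReal ((L₁ + L₂) * V) =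
              ENNReal.ofReal (L₁ * V) + ENNReal.ofReal (L₂ * V) := by
            rw [add_mul, ENNReal.ofReal_add (by positivity) (by positivity)]
          rw [this]
          refine mul_le_mul' (add_le_add hIb hIa) ?_
          rw [add_comm]
          exact add_le_add hIb hIa
      _ = _ := by rw [← ENNReal.ofReal_mul (by positivity), sq]
  have hBfin : ∀ i, volume (B i) ≠ ⊤ := fun i =>
    ne_top_of_le_ne_top (b := volume Q) (by simp [hQ, Measure.volume_eq_prod])
      (measure_mono inter_subset_left)
  have hreal : ∑ i, volume.real (B i) * (u i - u k) ^ 2 ≤ ((L₁ + L₂) * V) ^ 2 := by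
    rw [← ENNReal.ofReal_le_ofReal_iff (by positivity)]
    rw [ENNReal.ofReal_sum_of_nonneg fun _ _ => by positivity]
    refine le_of_eq_of_le (Finset.sum_congr rfl fun i _ => ?_) hmain
    rw [ENNReal.ofReal_mul measureReal_nonneg, ofReal_measureReal (hBfin i)]
  calc ∑ i, volume.real (A i ∩ para x e f) * (u i - u k) ^ 2
      = |cross e f| * ∑ i, volume.real (B i) * (u i - u k) ^ 2 := by
        rw [Finset.mul_sum]
        refine Finset.sum_congr rfl fun i _ => ?_
        have : A i ∩ para x e f = paraMap x e f '' B i := by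
          rw [hB, image_inter_preimage, inter_comm]; rfl
        rw [this, measureReal_def, volume_image_paraMap, ENNReal.toReal_mul,
          ENNReal.toReal_ofReal (abs_nonneg _), measureReal_def, mul_assoc]
    _ ≤ |cross e f| * ((L₁ + L₂) * V) ^ 2 := by gcongr
    _ = |cross e f| * (L₁ + L₂) ^ 2 * V ^ 2 := by ring

/-! ### Triangles -/

lemma cross_ne_zero_of_affineIndependent {P A B : Plane} (h : AffineIndependent ℝ ![P, A, B]) :
    cross (A - P) (B - P) ≠ 0 := by
  intro h0
  have hli : LinearIndependent ℝ ![A - P, B - P] := by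
    rw [affineIndependent_iff_linearIndependent_vsub ℝ _ (0 : Fin 3)] at h
    let g : Fin 2 → {x : Fin 3 // x ≠ 0} := ![⟨1, by decide⟩, ⟨2, by decide⟩]
    have hg : Function.Injective g := by decide
    have h2 := h.comp g hg
    have h3 : (fun i : {x : Fin 3 // x ≠ 0} => (![P, A, B] i -ᵥ ![P, A, B] 0 : Plane)) ∘ g =
        ![A - P, B - P] := by
      ext i
      fin_cases i <;> simp [g]
    rwa [h3] at h2
  rw [LinearIndependent.pair_iff] at hli
  set a := A - P
  set b := B - P
  have e1 : b 1 • a + (-a 1) • b = 0 := by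
    have : cross a b = 0 := h0
    simp only [cross] at this
    ext i; fin_cases i <;> simp <;> linarith
  have e2 : b 0 • a + (-a 0) • b = 0 := by
    have : cross a b = 0 := h0
    simp only [cross] at this
    ext i; fin_cases i <;> simp <;> linarith
  have ha1 : a 1 = 0 := by simpa using (hli _ _ e1).2
  have ha0 : a 0 = 0 := by simpa using (hli _ _ e2).2
  have ha : a = 0 := by ext i; fin_cases i <;> simp [ha0, ha1]
  exact one_ne_zero (hli 1 0 (by simp [ha])).1

lemma mem_convexHull_triple {P A B z : Plane} (hz : z ∈ convexHull ℝ {P, A, B}) :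
    ∃ s t : ℝ, 0 ≤ s ∧ 0 ≤ t ∧ s + t ≤ 1 ∧ z = P + s • (A - P) + t • (B - P) := by
  rw [convexHull_insert (by simp), convexHull_pair, mem_convexJoin] at hz
  obtain ⟨_, rfl, y, ⟨c, d, hc, hd, hcd, rfl⟩, c', d', hc', hd', hcd', rfl⟩ := hz
  refine ⟨d' * c, d' * d, by positivity, by positivity, by rw [← mul_add, hcd]; linarith, ?_⟩
  obtain rfl : c' = 1 - d' := by linarith
  obtain rfl : d = 1 - c := by linarith
  module

/-- The open parallelogram at the corner `P` of the triangle `P A B` whose sides are halves of the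
sides of the triangle. -/
def halfPara (P A B : Plane) : Set Plane :=
  para P ((1 / 2 : ℝ) • (A - P)) ((1 / 2 : ℝ) • (B - P))

lemma cross_half (P A B : Plane) : cross ((1 / 2 : ℝ) • (A - P)) ((1 / 2 : ℝ) • (B - P)) =
    cross (A - P) (B - P) / 4 := by
  rw [cross_smul_left, cross_smul_right]; ring

lemma isOpen_halfPara {P A B : Plane} (h : cross (A - P) (B - P) ≠ 0) : IsOpen (halfPara P A B) :=
  isOpen_para (by rw [cross_half]; positivity)

lemma mem_halfPara {P A B z : Plane} (hz : z ∈ halfPara P A B) :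
    ∃ s t : ℝ, 0 < s ∧ 0 < t ∧ s < 1 / 2 ∧ t < 1 / 2 ∧ z = P + s • (A - P) + t • (B - P) := by
  obtain ⟨⟨s, t⟩, ⟨hs, ht⟩, rfl⟩ := hz
  simp only [mem_Ioo] at hs ht
  refine ⟨s / 2, t / 2, by linarith, by linarith, by linarith, by linarith, ?_⟩
  simp only [paraMap, smul_smul]
  ring_nf

lemma halfPara_subset_convexHull (P A B : Plane) : halfPara P A B ⊆ convexHull ℝ {P, A, B} := by
  intro z hz
  obtain ⟨s, t, hs, ht, hs', ht', rfl⟩ := mem_halfPara hz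
  have := (convex_convexHull ℝ {P, A, B}).sum_mem (t := Finset.univ) (w := ![1 - s - t, s, t])
    (z := ![P, A, B]) (by intro i _; fin_cases i <;> simp <;> linarith)
    (by simp [Fin.sum_univ_three]; ring)
    (by intro i _; fin_cases i <;> exact subset_convexHull ℝ _ (by simp))
  convert this using 1
  simp [Fin.sum_univ_three]
  module

lemma halfPara_subset_interior {P A B : Plane} (h : cross (A - P) (B - P) ≠ 0) {S : Set Plane}
    (hS : convexHull ℝ {P, A, B} ⊆ S) : halfPara P A B ⊆ interior S :=
  interior_maximal ((halfPara_subset_convexHull P A B).trans hS) (isOpen_halfPara h)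

lemma mem_closure_halfPara {P A B : Plane} {s t : ℝ} (hs : 0 ≤ s) (ht : 0 ≤ t) (hs' : s ≤ 1 / 2)
    (ht' : t ≤ 1 / 2) : P + s • (A - P) + t • (B - P) ∈ closure (halfPara P A B) := by
  apply image_closedSquare_subset
  refine ⟨(2 * s, 2 * t), ⟨⟨by linarith, by linarith⟩, ⟨by linarith, by linarith⟩⟩, ?_⟩
  simp only [paraMap, smul_smul]
  ring_nf

/-- A triangle is covered by the three half-parallelograms at its corners, since at most one
barycentric coordinate exceeds `1/2`. -/
lemma convexHull_triple_subset (P A B : Plane) : convexHull ℝ {P, A, B} ⊆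
    closure (halfPara P A B) ∪ (closure (halfPara A B P) ∪ closure (halfPara B P A)) := by
  intro z hz
  obtain ⟨s, t, hs, ht, hst, rfl⟩ := mem_convexHull_triple hz
  rcases le_or_gt s (1 / 2) with h1 | h1
  · rcases le_or_gt t (1 / 2) with h2 | h2
    · exact Or.inl (mem_closure_halfPara hs ht h1 h2)
    · right; right
      have := mem_closure_halfPara (P := B) (A := P) (B := A) (s := 1 - s - t) (t := s)
        (by linarith) hs (by linarith) (by linarith)
      convert this using 1
      module
  · right; left
    have := mem_closure_halfPara (P := A) (A := B) (B := P) (s := t) (t := 1 - s - t)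
      ht (by linarith) (by linarith) (by linarith)
    convert this using 1
    module

/-! ### The Poincaré inequality on a polygonal domain -/

lemma sum_measureReal_inter {Ω U : Set Plane} (hΩ : volume Ω ≠ ⊤) (hU : MeasurableSet U)
    (hUΩ : U ⊆ Ω) {ι E : Type} [Fintype ι] {A : ι → Set Plane} {a b : E → Plane} {l r : E → ι}
    (hA : IsInterface Ω A a b l r) : ∑ i, volume.real (A i ∩ U) = volume.real U := by
  have hUfin : volume U ≠ ⊤ := ne_top_of_le_ne_top hΩ (measure_mono hUΩ)
  have h1 : volume U = volume (⋃ i, A i ∩ U) := by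
    apply measure_congr
    rw [← iUnion_inter]
    refine Filter.EventuallyLE.antisymm ?_ (ae_of_all _ inter_subset_right)
    rw [ae_le_set]
    refine measure_mono_null ?_ hA.null
    rintro z ⟨hz, hz'⟩
    exact ⟨hUΩ hz, fun h => hz' ⟨h, hz⟩⟩
  rw [measureReal_def, h1, measure_iUnion, tsum_fintype, ENNReal.toReal_sum]
  · rfl
  · exact fun i _ => ne_top_of_le_ne_top hUfin (measure_mono inter_subset_right)
  · intro i j hij
    exact (hA.partition.disjoint i j hij).mono inter_subset_left inter_subset_left
  · exact fun i => (hA.partition.isOpen i).measurableSet.inter hU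

lemma HasPoincare.union {Ω U V : Set Plane} (hΩ : volume Ω ≠ ⊤) {C₁ C₂ : ℝ}
    (hU : HasPoincare Ω U C₁) (hV : HasPoincare Ω V C₂) (hUo : IsOpen U) (hVo : IsOpen V)
    (hUΩ : U ⊆ Ω) (hVΩ : V ⊆ Ω) (hUV : (U ∩ V).Nonempty) : ∃ C, HasPoincare Ω (U ∪ V) C := by
  set w := volume.real (U ∩ V) with hw
  have hfin : ∀ S ⊆ Ω, volume S ≠ ⊤ := fun S hS => ne_top_of_le_ne_top hΩ (measure_mono hS)
  have hw0 : 0 < w := ENNReal.toReal_pos ((hUo.inter hVo).measure_pos volume hUV).ne'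
    (hfin _ (inter_subset_left.trans hUΩ))
  refine ⟨C₁ + (2 * C₂ + 2 * (volume.real V * (2 * (C₁ + C₂) / w))), ?_⟩
  intro ι E _ _ A a b l r hA u
  obtain ⟨c₁, hc₁⟩ := hU A a b l r hA u
  obtain ⟨c₂, hc₂⟩ := hV A a b l r hA u
  set T := totalVar a b l r u ^ 2
  have hmono : ∀ S S', S ⊆ S' → S' ⊆ Ω → ∀ i, volume.real (A i ∩ S) ≤ volume.real (A i ∩ S') :=
    fun S S' h h' i => measureReal_mono (inter_subset_inter_right _ h)
      (hfin _ (inter_subset_right.trans h'))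
  have hdiff : (c₂ - c₁) ^ 2 ≤ 2 * (C₁ + C₂) / w * T := by
    rw [div_mul_eq_mul_div, le_div_iff₀ hw0, hw,
      ← sum_measureReal_inter hΩ (hUo.inter hVo).measurableSet (inter_subset_left.trans hUΩ) hA,
      Finset.mul_sum]
    calc ∑ i, (c₂ - c₁) ^ 2 * volume.real (A i ∩ (U ∩ V))
        ≤ ∑ i, (2 * (volume.real (A i ∩ U) * (u i - c₁) ^ 2) +
            2 * (volume.real (A i ∩ V) * (u i - c₂) ^ 2)) := by
          refine Finset.sum_le_sum fun i _ => ?_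
          have h1 := hmono (U ∩ V) U inter_subset_left hUΩ i
          have h2 := hmono (U ∩ V) V inter_subset_right hVΩ i
          have h0 : 0 ≤ volume.real (A i ∩ (U ∩ V)) := measureReal_nonneg
          nlinarith [mul_le_mul_of_nonneg_right h1 (sq_nonneg (u i - c₁)),
            mul_le_mul_of_nonneg_right h2 (sq_nonneg (u i - c₂)),
            mul_nonneg h0 (sq_nonneg ((u i - c₁) + (u i - c₂)))]
      _ ≤ 2 * (C₁ * T) + 2 * (C₂ * T) := by
          rw [Finset.sum_add_distrib, ← Finset.mul_sum, ← Finset.mul_sum]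
          gcongr
      _ = 2 * (C₁ + C₂) * T := by ring
  refine ⟨c₁, ?_⟩
  calc ∑ i, volume.real (A i ∩ (U ∪ V)) * (u i - c₁) ^ 2
      ≤ ∑ i, (volume.real (A i ∩ U) * (u i - c₁) ^ 2 +
          (2 * (volume.real (A i ∩ V) * (u i - c₂) ^ 2) +
            2 * (volume.real (A i ∩ V) * (c₂ - c₁) ^ 2))) := by
        refine Finset.sum_le_sum fun i _ => ?_
        have h1 : volume.real (A i ∩ (U ∪ V)) ≤
            volume.real (A i ∩ U) + volume.real (A i ∩ V) := by
          rw [inter_union_distrib_left]; exact measureReal_union_le _ _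
        have h0 : 0 ≤ volume.real (A i ∩ V) := measureReal_nonneg
        nlinarith [mul_le_mul_of_nonneg_right h1 (sq_nonneg (u i - c₁)),
          mul_nonneg h0 (sq_nonneg ((u i - c₂) - (c₂ - c₁)))]
    _ ≤ C₁ * T + (2 * (C₂ * T) + 2 * (volume.real V * (2 * (C₁ + C₂) / w * T))) := by
        rw [Finset.sum_add_distrib, Finset.sum_add_distrib, ← Finset.mul_sum, ← Finset.mul_sum,
          ← Finset.sum_mul, sum_measureReal_inter hΩ hVo.measurableSet hVΩ hA]
        gcongr
    _ = _ := by ring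

/-- An open subset of `Ω` which satisfies the Poincaré inequality with some constant. -/
structure IsPoincareOpen (Ω U : Set Plane) : Prop where
  isOpen : IsOpen U
  subset : U ⊆ Ω
  poincare : ∃ C, HasPoincare Ω U C

lemma IsPoincareOpen.union {Ω U V : Set Plane} (hΩ : volume Ω ≠ ⊤) (hU : IsPoincareOpen Ω U)
    (hV : IsPoincareOpen Ω V) (hUV : (U ∩ V).Nonempty) : IsPoincareOpen Ω (U ∪ V) := by
  obtain ⟨C₁, h₁⟩ := hU.poincare
  obtain ⟨C₂, h₂⟩ := hV.poincare
  exact ⟨hU.isOpen.union hV.isOpen, union_subset hU.subset hV.subset,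
    h₁.union hΩ h₂ hU.isOpen hV.isOpen hU.subset hV.subset hUV⟩

lemma isPoincareOpen_para {Ω : Set Plane} {x e f : Plane} (h : cross e f ≠ 0)
    (hP : para x e f ⊆ Ω) : IsPoincareOpen Ω (para x e f) :=
  ⟨isOpen_para h, hP, exists_hasPoincare_para h hP⟩

lemma exists_isPoincareOpen_mem {Ω : Set Plane} (hΩ : IsOpen Ω) {x : Plane} (hx : x ∈ Ω) :
    ∃ U, IsPoincareOpen Ω U ∧ x ∈ U := by
  obtain ⟨δ, hδ, hball⟩ := Metric.isOpen_iff.1 hΩ x hx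
  set e : Plane := δ • !₂[1, 0] with he
  set f : Plane := δ • !₂[0, 1] with hf
  have hef : cross e f ≠ 0 := by simp [cross, he, hf, hδ.ne']
  refine ⟨para (x - (1 / 2 : ℝ) • e - (1 / 2 : ℝ) • f) e f, isPoincareOpen_para hef ?_,
    ⟨(1 / 2, 1 / 2), by norm_num, by simp only [paraMap]; module⟩⟩
  rintro _ ⟨⟨s, t⟩, ⟨hs, ht⟩, rfl⟩
  simp only [mem_Ioo] at hs ht
  apply hball
  rw [mem_ball_iff_norm]
  have he' : ‖e‖ = δ := by simp [he, norm_smul, EuclideanSpace.norm_eq, abs_of_pos hδ]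
  have hf' : ‖f‖ = δ := by simp [hf, norm_smul, EuclideanSpace.norm_eq, abs_of_pos hδ]
  have : paraMap (x - (1 / 2 : ℝ) • e - (1 / 2 : ℝ) • f) e f (s, t) - x =
      (s - 1 / 2) • e + (t - 1 / 2) • f := by
    simp only [paraMap]; module
  rw [this]
  have hs2 : |s - 1 / 2| < 1 / 2 := by rw [abs_lt]; constructor <;> linarith
  have ht2 : |t - 1 / 2| < 1 / 2 := by rw [abs_lt]; constructor <;> linarith
  calc _ ≤ |s - 1 / 2| * δ + |t - 1 / 2| * δ := by
        refine (norm_add_le _ _).trans ?_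
        rw [norm_smul _ e, norm_smul _ f, he', hf']; rfl
    _ < 1 / 2 * δ + 1 / 2 * δ := by gcongr
    _ = δ := by ring

/-- In a connected domain any two points lie in a common open set with the Poincaré inequality. -/
lemma exists_isPoincareOpen_pair {Ω : Set Plane} (hΩ : IsOpen Ω) (hfin : volume Ω ≠ ⊤)
    (hc : IsPreconnected Ω) {x y : Plane} (hx : x ∈ Ω) (hy : y ∈ Ω) :
    ∃ U, IsPoincareOpen Ω U ∧ x ∈ U ∧ y ∈ U := by
  refine hc.induction₂ (fun x y => ∃ U, IsPoincareOpen Ω U ∧ x ∈ U ∧ y ∈ U) ?_ ?_ ?_ hx hy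
  · intro x hx
    obtain ⟨U, hU, hxU⟩ := exists_isPoincareOpen_mem hΩ hx
    filter_upwards [mem_nhdsWithin_of_mem_nhds (hU.isOpen.mem_nhds hxU)] with y hy
    exact ⟨U, hU, hxU, hy⟩
  · rintro x y z - - - ⟨U, hU, hx, hy⟩ ⟨V, hV, hy', hz⟩
    exact ⟨U ∪ V, hU.union hfin hV ⟨y, hy, hy'⟩, Or.inl hx, Or.inr hz⟩
  · rintro x y - - ⟨U, hU, hx, hy⟩
    exact ⟨U, hU, hy, hx⟩

lemma exists_isPoincareOpen_para {Ω : Set Plane} (hΩ : IsOpen Ω) (hfin : volume Ω ≠ ⊤)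
    (hc : IsPreconnected Ω) {x₀ : Plane} (hx₀ : x₀ ∈ Ω) {x e f : Plane} (h : cross e f ≠ 0)
    (hP : para x e f ⊆ Ω) :
    ∃ U, IsPoincareOpen Ω U ∧ x₀ ∈ U ∧ volume (closure (para x e f) \ U) = 0 := by
  have hm : paraMap x e f (1 / 2, 1 / 2) ∈ para x e f := ⟨_, by norm_num, rfl⟩
  obtain ⟨U, hU, h0, h1⟩ := exists_isPoincareOpen_pair hΩ hfin hc hx₀ (hP hm)
  refine ⟨U ∪ para x e f, hU.union hfin (isPoincareOpen_para h hP) ⟨_, h1, hm⟩, Or.inl h0, ?_⟩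
  refine measure_mono_null ?_ ((convex_para x e f).addHaar_frontier volume)
  rw [(isOpen_para h).frontier_eq]
  exact sdiff_subset_sdiff_right subset_union_right

lemma exists_isPoincareOpen_triangle {Ω : Set Plane} (hΩ : IsOpen Ω) (hfin : volume Ω ≠ ⊤)
    (hc : IsPreconnected Ω) {x₀ : Plane} (hx₀ : x₀ ∈ Ω) {P A B : Plane}
    (h : cross (A - P) (B - P) ≠ 0) (hP : interior (convexHull ℝ {P, A, B}) ⊆ Ω) :
    ∃ U, IsPoincareOpen Ω U ∧ x₀ ∈ U ∧ volume (convexHull ℝ {P, A, B} \ U) = 0 := by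
  have key : ∀ P' A' B', cross (A' - P') (B' - P') ≠ 0 →
      convexHull ℝ {P', A', B'} ⊆ convexHull ℝ {P, A, B} →
      ∃ U, IsPoincareOpen Ω U ∧ x₀ ∈ U ∧ volume (closure (halfPara P' A' B') \ U) = 0 := by
    intro P' A' B' h' hsub
    exact exists_isPoincareOpen_para hΩ hfin hc hx₀ (by rw [cross_half]; positivity)
      ((halfPara_subset_interior h' hsub).trans hP)
  obtain ⟨U₁, h₁, m₁, n₁⟩ := key P A B h subset_rfl
  obtain ⟨U₂, h₂, m₂, n₂⟩ := key A B P
    (by convert h using 1; simp [cross]; ring) (convexHull_mono (by grind))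
  obtain ⟨U₃, h₃, m₃, n₃⟩ := key B P A
    (by convert h using 1; simp [cross]; ring) (convexHull_mono (by grind))
  refine ⟨U₁ ∪ (U₂ ∪ U₃), h₁.union hfin (h₂.union hfin h₃ ⟨_, m₂, m₃⟩) ⟨_, m₁, Or.inl m₂⟩,
    Or.inl m₁, measure_mono_null ?_ (measure_union_null n₁ (measure_union_null n₂ n₃))⟩
  rintro z ⟨hz, hz'⟩
  simp only [mem_union, not_or] at hz'
  rcases convexHull_triple_subset P A B hz with h | h | h
  · exact Or.inl ⟨h, hz'.1⟩
  · exact Or.inr (Or.inl ⟨h, hz'.2.1⟩)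
  · exact Or.inr (Or.inr ⟨h, hz'.2.2⟩)

/-- The Poincaré inequality on a polygonal domain: up to a null set, the domain is a finite union
of overlapping open sets with the Poincaré inequality. -/
theorem IsPolygonalDomain.exists_hasPoincare {Ω : Set Plane} (hΩ : IsPolygonalDomain Ω) :
    ∃ C, HasPoincare Ω Ω C := by
  have hfin : volume Ω ≠ ⊤ := hΩ.isBounded.measure_lt_top.ne
  obtain ⟨x₀, hx₀⟩ := hΩ.isConnected.nonempty
  obtain ⟨T, hT, hΩT⟩ := hΩ.polygonal
  have hunion : ∀ S ⊆ T, ∃ U, IsPoincareOpen Ω U ∧ x₀ ∈ U ∧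
      volume ((⋃ t ∈ S, convexHull ℝ (range t)) \ U) = 0 := by
    intro S
    induction S using Finset.induction_on with
    | empty =>
      intro _
      obtain ⟨U, hU, h0⟩ := exists_isPoincareOpen_mem hΩ.isOpen hx₀
      exact ⟨U, hU, h0, by simp⟩
    | insert t S _ ih =>
      intro hS
      obtain ⟨U, hU, h0, hn⟩ := ih ((Finset.subset_insert _ _).trans hS)
      have htT : t ∈ T := hS (Finset.mem_insert_self _ _)
      have hrange : range t = {t 0, t 1, t 2} := by
        ext z; simp [Fin.exists_fin_succ, eq_comm]
      have htt : t = ![t 0, t 1, t 2] := by ext i; fin_cases i <;> rfl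
      have hc := cross_ne_zero_of_affineIndependent (htt ▸ hT t htT)
      have hsub : interior (convexHull ℝ {t 0, t 1, t 2}) ⊆ Ω := by
        rw [hΩT, ← hrange]
        exact interior_mono (subset_biUnion_of_mem (u := fun t => convexHull ℝ (range t)) htT)
      obtain ⟨V, hV, h0', hn'⟩ := exists_isPoincareOpen_triangle hΩ.isOpen hfin
        hΩ.isConnected.isPreconnected hx₀ hc hsub
      refine ⟨U ∪ V, hU.union hfin hV ⟨_, h0, h0'⟩, Or.inl h0, ?_⟩
      refine measure_mono_null ?_ (measure_union_null hn hn')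
      rw [Finset.set_biUnion_insert, ← hrange, union_sdiff_distrib, union_comm]
      exact union_subset_union (sdiff_subset_sdiff_right subset_union_left)
        (sdiff_subset_sdiff_right subset_union_right)
  obtain ⟨U, hU, -, hn⟩ := hunion T subset_rfl
  obtain ⟨C, hC⟩ := hU.poincare
  refine ⟨C, ?_⟩
  intro ι E _ _ A a b l r hA u
  obtain ⟨c, hc⟩ := hC A a b l r hA u
  refine ⟨c, le_of_eq_of_le (Finset.sum_congr rfl fun i _ => ?_) hc⟩
  congr 1
  apply measureReal_congr
  refine Filter.EventuallyLE.antisymm ?_ (ae_of_all _ (inter_subset_inter_right _ hU.subset))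
  rw [ae_le_set]
  refine measure_mono_null ?_ hn
  rintro z ⟨⟨hzA, hzΩ⟩, hz⟩
  refine ⟨?_, fun h => hz ⟨hzA, h⟩⟩
  rw [hΩT] at hzΩ
  exact interior_subset hzΩ

/-! ### The entropy bound -/

lemma mul_log_sq_le {g : ℝ} (hg : 0 < g) :
    g ^ 2 * Real.log (g ^ 2) ≤ (g ^ 2 - 1) + (3 * (g - 1) ^ 2 + 2 * |g - 1| ^ 3) := by
  have h1 : Real.log (g ^ 2) ≤ 2 * (g - 1) := by
    rw [Real.log_pow]
    have := Real.log_le_sub_one_of_pos hg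
    push_cast
    linarith
  have h2 : (g - 1) ^ 3 ≤ |g - 1| ^ 3 := by
    rw [← abs_pow]; exact le_abs_self _
  nlinarith [mul_le_mul_of_nonneg_left h1 (sq_nonneg g)]

/-- The relative entropy of `v` with respect to `w` is controlled by the `L⁴` distance of
`√(v / w)` to any nonnegative constant. With `g = √(v / w)` and `k = g - 1`, the integrand
`g² log g² - g² + 1` is at most `3 k² + 2 |k|³`, and equality of the masses bounds the `L²` norm of
`k` and the distance of the constant to `1`. -/
lemma sum_mul_log_le {ι : Type} [Fintype ι] {m v w : ι → ℝ} {M W c : ℝ} (hm : ∀ i, 0 ≤ m i)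
    (hv : ∀ i, 0 < v i) (hw : ∀ i, 0 < w i) (hW : ∀ i, w i ≤ W) (hMv : ∑ i, m i * v i = M)
    (hMw : ∑ i, m i * w i = M) (hW0 : 0 ≤ W) (hc : 0 ≤ c) :
    ∑ i, m i * (v i * Real.log (v i / w i)) ≤
      24 * √(M * W) * √(∑ i, m i * (√(v i / w i) - c) ^ 4) := by
  set g : ι → ℝ := fun i => √(v i / w i) with hgdef
  set n : ι → ℝ := fun i => m i * w i with hndef
  have hg : ∀ i, 0 < g i := fun i => Real.sqrt_pos.2 (div_pos (hv i) (hw i))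
  have hg2 : ∀ i, g i ^ 2 = v i / w i := fun i => Real.sq_sqrt (div_pos (hv i) (hw i)).le
  have hvg : ∀ i, v i = w i * g i ^ 2 := fun i => by
    rw [hg2, mul_div_cancel₀ _ (hw i).ne']
  have hn : ∀ i, 0 ≤ n i := fun i => mul_nonneg (hm i) (hw i).le
  have hnM : ∑ i, n i = M := hMw
  have hngM : ∑ i, n i * g i ^ 2 = M := by
    rw [← hMv]
    refine Finset.sum_congr rfl fun i _ => ?_
    rw [hvg i, hndef]; ring
  have hM : 0 ≤ M := hnM ▸ Finset.sum_nonneg fun i _ => hn i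
  set Q := ∑ i, n i * (g i - 1) ^ 4 with hQ
  set R := ∑ i, n i * (g i - c) ^ 4 with hR
  set S := ∑ i, m i * (g i - c) ^ 4 with hS
  have hQ0 : 0 ≤ Q := Finset.sum_nonneg fun i _ => mul_nonneg (hn i) (by positivity)
  have hS0 : 0 ≤ S := Finset.sum_nonneg fun i _ => mul_nonneg (hm i) (by positivity)
  have hR0 : 0 ≤ R := Finset.sum_nonneg fun i _ => mul_nonneg (hn i) (by positivity)
  have hcs : ∀ a : ℝ, (∑ i, n i * (g i - a) ^ 2) ^ 2 ≤ M * ∑ i, n i * (g i - a) ^ 4 := by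
    intro a
    rw [← hnM]
    refine Finset.sum_sq_le_sum_mul_sum_of_sq_le_mul _ (fun i _ => hn i)
      (fun i _ => mul_nonneg (hn i) (by positivity)) fun i _ => by apply le_of_eq; ring
  have hsum2 : ∑ i, n i * (g i - 1) ^ 2 ≤ 2 * M := by
    have : ∑ i, n i * (g i - 1) ^ 2 ≤ ∑ i, (n i * g i ^ 2 + n i) :=
      Finset.sum_le_sum fun i _ => by nlinarith [mul_nonneg (hn i) (hg i).le]
    rw [Finset.sum_add_distrib, hngM, hnM] at this
    linarith
  have hsum2' : ∑ i, n i * (g i - 1) ^ 2 ≤ √(M * Q) := Real.le_sqrt_of_sq_le (hcs 1)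
  have hsum3 : 2 * ∑ i, n i * |g i - 1| ^ 3 ≤ 3 * √(M * Q) := by
    have h1 : (∑ i, n i * |g i - 1| ^ 3) ^ 2 ≤ (∑ i, n i * (g i - 1) ^ 2) * Q := by
      refine Finset.sum_sq_le_sum_mul_sum_of_sq_le_mul _
        (fun i _ => mul_nonneg (hn i) (by positivity))
        (fun i _ => mul_nonneg (hn i) (by positivity)) fun i _ => ?_
      rw [mul_pow, ← pow_mul, mul_comm 3 2, pow_mul, sq_abs]; apply le_of_eq; ring
    refine abs_le_of_sq_le_sq' ?_ (by positivity) |>.2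
    rw [mul_pow, mul_pow, Real.sq_sqrt (by positivity)]
    nlinarith [mul_le_mul_of_nonneg_right hsum2 hQ0, mul_nonneg hM hQ0]
  have hent : ∑ i, m i * (v i * Real.log (v i / w i)) ≤ 6 * √(M * Q) := by
    calc ∑ i, m i * (v i * Real.log (v i / w i))
        ≤ ∑ i, ((n i * g i ^ 2 - n i) + (3 * (n i * (g i - 1) ^ 2) +
            2 * (n i * |g i - 1| ^ 3))) := by
          refine Finset.sum_le_sum fun i _ => ?_
          have := mul_le_mul_of_nonneg_left (mul_log_sq_le (hg i)) (hn i)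
          rw [hg2 i] at this ⊢
          have h2 : m i * (v i * Real.log (v i / w i)) =
              n i * (v i / w i * Real.log (v i / w i)) := by
            have := (hw i).ne'
            rw [hndef]; field_simp
          rw [h2]
          linarith
      _ = 3 * (∑ i, n i * (g i - 1) ^ 2) + 2 * ∑ i, n i * |g i - 1| ^ 3 := by
          rw [Finset.sum_add_distrib, Finset.sum_sub_distrib, Finset.sum_add_distrib, hngM, hnM,
            Finset.mul_sum, Finset.mul_sum]
          ring
      _ ≤ 6 * √(M * Q) := by linarith
  have hc4 : M * (1 - c) ^ 4 ≤ R := by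
    have h1 : M * (1 - c) ^ 2 ≤ ∑ i, n i * (g i - c) ^ 2 := by
      have : ∑ i, ((1 - c) * (n i * g i ^ 2) + (c ^ 2 - c) * n i) ≤
          ∑ i, n i * (g i - c) ^ 2 :=
        Finset.sum_le_sum fun i _ => by
          nlinarith [mul_nonneg hc (mul_nonneg (hn i) (sq_nonneg (g i - 1)))]
      rw [Finset.sum_add_distrib, ← Finset.mul_sum, ← Finset.mul_sum, hngM, hnM] at this
      linarith
    have h2 : (M * (1 - c) ^ 2) ^ 2 ≤ M * R :=
      (pow_le_pow_left₀ (by positivity) h1 2).trans (hcs c)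
    rcases hM.eq_or_lt with h0 | h0
    · rw [← h0, zero_mul]; exact hR0
    · exact le_of_mul_le_mul_left (by linarith) h0
  have hQR : Q ≤ 16 * R := by
    have : Q ≤ ∑ i, (8 * (n i * (g i - c) ^ 4) + 8 * (1 - c) ^ 4 * n i) := by
      refine Finset.sum_le_sum fun i _ => ?_
      have : (g i - 1) ^ 4 ≤ 8 * (g i - c) ^ 4 + 8 * (1 - c) ^ 4 := by
        have h1 : (g i - 1) ^ 2 ≤ 2 * (g i - c) ^ 2 + 2 * (1 - c) ^ 2 := by
          nlinarith [sq_nonneg (g i - c + (1 - c))]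
        have h2 := pow_le_pow_left₀ (sq_nonneg _) h1 2
        nlinarith [sq_nonneg ((g i - c) ^ 2 - (1 - c) ^ 2)]
      nlinarith [mul_le_mul_of_nonneg_left this (hn i)]
    rw [Finset.sum_add_distrib, ← Finset.mul_sum, ← Finset.mul_sum, hnM] at this
    linarith
  have hRS : R ≤ W * S := by
    rw [hS, Finset.mul_sum]
    refine Finset.sum_le_sum fun i _ => ?_
    have : 0 ≤ m i * (g i - c) ^ 4 := mul_nonneg (hm i) (by positivity)
    nlinarith [mul_le_mul_of_nonneg_left (hW i) this]
  calc _ ≤ 6 * √(M * Q) := hent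
    _ ≤ 6 * √(4 ^ 2 * (M * W * S)) := by
        refine mul_le_mul_of_nonneg_left (Real.sqrt_le_sqrt ?_) (by norm_num)
        nlinarith [mul_le_mul_of_nonneg_left (hQR.trans (mul_le_mul_of_nonneg_left hRS
          (by norm_num : (0 : ℝ) ≤ 16))) hM]
    _ = _ := by
        rw [Real.sqrt_mul (by norm_num), Real.sqrt_mul (mul_nonneg hM hW0),
          Real.sqrt_sq (by norm_num)]
        ring

/-! ### From the Poincaré inequality to the Sobolev inequality -/

lemma abs_mul_abs_sub_le (x y : ℝ) : |(x * |x|) - (y * |y|)| ≤ |x - y| * (|x| + |y|) := by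
  have h : x * |x| - y * |y| = (x - y) * |x| + y * (|x| - |y|) := by ring
  rw [h]
  refine (abs_add_le _ _).trans ?_
  rw [abs_mul, abs_mul, abs_abs, mul_add, mul_comm |y|]
  exact add_le_add le_rfl (mul_le_mul_of_nonneg_right (abs_abs_sub_abs_le x y) (abs_nonneg y))

lemma exists_sum_mul_abs_eq_zero {ι : Type} [Fintype ι] {m g : ι → ℝ} (hm : ∀ i, 0 ≤ m i)
    (hg : ∀ i, 0 ≤ g i) : ∃ c, 0 ≤ c ∧ ∑ i, m i * ((g i - c) * |g i - c|) = 0 := by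
  have hcont : Continuous fun c => ∑ i, m i * ((g i - c) * |g i - c|) := by fun_prop
  have hb : 0 ≤ ∑ i, g i := Finset.sum_nonneg fun i _ => hg i
  obtain ⟨c, hc, hc'⟩ := intermediate_value_Icc' hb hcont.continuousOn (show (0 : ℝ) ∈ Icc _ _ from
    ⟨Finset.sum_nonpos fun i _ => mul_nonpos_of_nonneg_of_nonpos (hm i)
      (mul_nonpos_of_nonpos_of_nonneg
        (sub_nonpos.2 (Finset.single_le_sum (fun i _ => hg i) (Finset.mem_univ i)))
        (abs_nonneg _)),
     Finset.sum_nonneg fun i _ => mul_nonneg (hm i)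
      (mul_nonneg (by simpa using hg i) (abs_nonneg _))⟩)
  exact ⟨c, hc.1, hc'⟩

/-- A discrete Sobolev inequality, from the `L²`-`BV` Poincaré inequality applied to
`(g - c) |g - c|`, with `c` such that this function has mean zero. Here `len` and `dlen` are lengths
of interfaces and of dual edges, `G` is the norm of a discrete gradient on the diamonds of areas
`D`, and `τ` are areas of disjoint pieces of the cells: each interface has such a piece, comparable
to `len * dlen`, in one of the two adjacent cells. -/
lemma exists_sqrt_sum_pow_four_le {ι E : Type} [Fintype ι] [Fintype E] [DecidableEq ι]
    {m g : ι → ℝ} {l r side : E → ι} {len dlen G D τ : E → ℝ} {C₀ κ d V : ℝ}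
    (hpoinc : ∀ u : ι → ℝ, ∃ c, ∑ i, m i * (u i - c) ^ 2 ≤
      C₀ * (∑ e, len e * |u (l e) - u (r e)|) ^ 2)
    (hC₀ : 0 ≤ C₀) (hκ : 0 ≤ κ) (hm : ∀ i, 0 ≤ m i) (hg : ∀ i, 0 ≤ g i) (hlen : ∀ e, 0 ≤ len e)
    (hdlen : ∀ e, 0 ≤ dlen e) (hD : ∀ e, 0 ≤ D e)
    (hdiff : ∀ e, |g (l e) - g (r e)| ≤ dlen e * G e) (hlenD : ∀ e, len e * dlen e ≤ κ * D e)
    (hside : ∀ e, side e = l e ∨ side e = r e) (hlenτ : ∀ e, len e * dlen e ≤ κ * τ e)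
    (hτ : ∀ i, ∑ e with side e = i, τ e ≤ m i) (hd : ∀ e, dlen e ≤ d) (hV : ∑ i, m i ≤ V) :
    ∃ c, 0 ≤ c ∧ √(∑ i, m i * (g i - c) ^ 4) ≤
      (8 * C₀ * κ ^ 2 * √V + 2 * C₀ * κ ^ 2 * d ^ 2 + 1) * ∑ e, D e * G e ^ 2 := by
  obtain ⟨c, hc, hc0⟩ := exists_sum_mul_abs_eq_zero hm hg
  refine ⟨c, hc, ?_⟩
  set h : ι → ℝ := fun i => g i - c with hh
  set X := √(∑ i, m i * h i ^ 4) with hX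
  set T := ∑ e, D e * G e ^ 2 with hT
  have hX0 : 0 ≤ X := Real.sqrt_nonneg _
  have hT0 : 0 ≤ T := Finset.sum_nonneg fun e _ => mul_nonneg (hD e) (sq_nonneg _)
  have hXsq : X ^ 2 = ∑ i, m i * h i ^ 4 :=
    Real.sq_sqrt (Finset.sum_nonneg fun i _ => mul_nonneg (hm i) (by positivity))
  have hV0 : 0 ≤ V := (Finset.sum_nonneg fun i _ => hm i).trans hV
  have hdiff' : ∀ e, |h (l e) - h (r e)| ≤ dlen e * G e := by
    intro e; simpa [hh] using hdiff e
  have h1 : X ^ 2 ≤ C₀ * (∑ e, len e * |(h (l e) * |h (l e)|) - (h (r e) * |h (r e)|)|) ^ 2 := by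
    obtain ⟨a, ha⟩ := hpoinc fun i => h i * |h i|
    refine le_trans ?_ ha
    have : ∑ i, m i * (h i * |h i| - a) ^ 2 = X ^ 2 + a ^ 2 * ∑ i, m i := by
      rw [hXsq, Finset.mul_sum, ← Finset.sum_add_distrib, ← sub_eq_zero, ← Finset.sum_sub_distrib,
        ← mul_zero (-2 * a), ← hc0, Finset.mul_sum]
      refine Finset.sum_congr rfl fun i _ => ?_
      have : |h i| ^ 2 = h i ^ 2 := sq_abs _
      have h4 : (h i * |h i| - a) ^ 2 = h i ^ 2 * |h i| ^ 2 - 2 * a * (h i * |h i|) + a ^ 2 := by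
        ring
      rw [h4, this]; ring
    rw [this]
    have := Finset.sum_nonneg fun i (_ : i ∈ Finset.univ) => hm i
    nlinarith [mul_nonneg (sq_nonneg a) this]
  set Y := ∑ e, len e * dlen e * (|h (l e)| + |h (r e)|) ^ 2 with hY
  have hld : ∀ e, 0 ≤ len e * dlen e := fun e => mul_nonneg (hlen e) (hdlen e)
  have h2 : (∑ e, len e * |(h (l e) * |h (l e)|) - (h (r e) * |h (r e)|)|) ^ 2 ≤ κ * T * Y := by
    calc _ ≤ (∑ e, len e * (dlen e * G e * (|h (l e)| + |h (r e)|))) ^ 2 := by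
          refine pow_le_pow_left₀ (Finset.sum_nonneg fun e _ =>
            mul_nonneg (hlen e) (abs_nonneg _)) (Finset.sum_le_sum fun e _ => ?_) 2
          refine mul_le_mul_of_nonneg_left ((abs_mul_abs_sub_le _ _).trans ?_) (hlen e)
          exact mul_le_mul_of_nonneg_right (hdiff' e) (by positivity)
      _ ≤ (∑ e, len e * dlen e * G e ^ 2) * Y :=
          Finset.sum_sq_le_sum_mul_sum_of_sq_le_mul _
            (fun e _ => mul_nonneg (hld e) (sq_nonneg _))
            (fun e _ => mul_nonneg (hld e) (sq_nonneg _)) fun e _ => by apply le_of_eq; ring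
      _ ≤ κ * T * Y := by
          refine mul_le_mul_of_nonneg_right ?_
            (Finset.sum_nonneg fun e _ => mul_nonneg (hld e) (sq_nonneg _))
          rw [hT, Finset.mul_sum]
          refine Finset.sum_le_sum fun e _ => ?_
          nlinarith [mul_le_mul_of_nonneg_right (hlenD e) (sq_nonneg (G e))]
  set Z := ∑ i, m i * h i ^ 2 with hZ
  have h3 : Y ≤ 8 * κ * Z + 2 * κ * d ^ 2 * T := by
    have h31 : ∀ e, len e * dlen e * (|h (l e)| + |h (r e)|) ^ 2 ≤
        8 * κ * (τ e * h (side e) ^ 2) + 2 * κ * d ^ 2 * (D e * G e ^ 2) := by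
      intro e
      have ha : (|h (l e)| + |h (r e)|) ^ 2 ≤
          8 * h (side e) ^ 2 + 2 * (dlen e * G e) ^ 2 := by
        have hsq : (h (l e) - h (r e)) ^ 2 ≤ (dlen e * G e) ^ 2 := by
          rw [← sq_abs]; exact pow_le_pow_left₀ (abs_nonneg _) (hdiff' e) 2
        have habs : (|h (l e)| + |h (r e)|) ^ 2 ≤ 2 * h (l e) ^ 2 + 2 * h (r e) ^ 2 := by
          nlinarith [sq_nonneg (|h (l e)| - |h (r e)|), sq_abs (h (l e)), sq_abs (h (r e))]
        rcases hside e with hs | hs <;> rw [hs]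
        · have : |h (r e)| ≤ |h (l e)| + dlen e * G e := by
            have := abs_sub_abs_le_abs_sub (h (r e)) (h (l e))
            rw [abs_sub_comm (h (r e)) (h (l e))] at this
            linarith [hdiff' e]
          have := pow_le_pow_left₀ (by positivity)
            (show |h (l e)| + |h (r e)| ≤ 2 * |h (l e)| + dlen e * G e by linarith) 2
          nlinarith [sq_nonneg (2 * |h (l e)| - dlen e * G e), sq_abs (h (l e))]
        · have : |h (l e)| ≤ |h (r e)| + dlen e * G e := by
            have := abs_sub_abs_le_abs_sub (h (l e)) (h (r e))
            linarith [hdiff' e]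
          have := pow_le_pow_left₀ (by positivity)
            (show |h (l e)| + |h (r e)| ≤ 2 * |h (r e)| + dlen e * G e by linarith) 2
          nlinarith [sq_nonneg (2 * |h (r e)| - dlen e * G e), sq_abs (h (r e))]
      have hb := mul_le_mul_of_nonneg_left ha (hld e)
      have hc1 := mul_le_mul_of_nonneg_right (hlenτ e) (sq_nonneg (h (side e)))
      have hd2 : dlen e ^ 2 ≤ d ^ 2 := pow_le_pow_left₀ (hdlen e) (hd e) 2
      have hc2 : len e * dlen e * (dlen e * G e) ^ 2 ≤ κ * D e * (d ^ 2 * G e ^ 2) := by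
        rw [mul_pow]
        exact mul_le_mul (hlenD e) (mul_le_mul_of_nonneg_right hd2 (sq_nonneg _))
          (by positivity) (mul_nonneg hκ (hD e))
      nlinarith
    have h32 : ∑ e, τ e * h (side e) ^ 2 ≤ Z := by
      rw [← Finset.sum_fiberwise (s := Finset.univ) (g := side)]
      refine Finset.sum_le_sum fun i _ => ?_
      calc ∑ e with side e = i, τ e * h (side e) ^ 2
          = (∑ e with side e = i, τ e) * h i ^ 2 := by
            rw [Finset.sum_mul]
            refine Finset.sum_congr rfl fun e he => ?_
            rw [(Finset.mem_filter.1 he).2]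
        _ ≤ m i * h i ^ 2 := mul_le_mul_of_nonneg_right (hτ i) (sq_nonneg _)
    calc Y ≤ ∑ e, (8 * κ * (τ e * h (side e) ^ 2) + 2 * κ * d ^ 2 * (D e * G e ^ 2)) :=
          Finset.sum_le_sum fun e _ => h31 e
      _ = 8 * κ * (∑ e, τ e * h (side e) ^ 2) + 2 * κ * d ^ 2 * T := by
          rw [Finset.sum_add_distrib, ← Finset.mul_sum, ← Finset.mul_sum]
      _ ≤ _ := by gcongr
  have h4 : Z ≤ √V * X := by
    refine abs_le_of_sq_le_sq' ?_ (by positivity) |>.2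
    rw [mul_pow, Real.sq_sqrt hV0, hXsq]
    calc Z ^ 2 ≤ (∑ i, m i) * ∑ i, m i * h i ^ 4 :=
          Finset.sum_sq_le_sum_mul_sum_of_sq_le_mul _ (fun i _ => hm i)
            (fun i _ => mul_nonneg (hm i) (by positivity)) fun i _ => by apply le_of_eq; ring
      _ ≤ _ := by
          rw [← hXsq]; gcongr
  set α := 8 * C₀ * κ ^ 2 * √V with hα
  set β := 2 * C₀ * κ ^ 2 * d ^ 2 with hβ
  have hα0 : 0 ≤ α := by positivity
  have hβ0 : 0 ≤ β := by positivity
  have h5 : X ^ 2 ≤ α * T * X + β * T ^ 2 := by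
    calc X ^ 2 ≤ C₀ * (κ * T * Y) := h1.trans (mul_le_mul_of_nonneg_left h2 hC₀)
      _ ≤ C₀ * (κ * T * (8 * κ * (√V * X) + 2 * κ * d ^ 2 * T)) := by
          gcongr
          exact h3.trans (by gcongr)
      _ = α * T * X + β * T ^ 2 := by rw [hα, hβ]; ring
  by_contra! hcon
  have hXT : T ≤ X := by nlinarith [mul_nonneg (add_nonneg hα0 hβ0) hT0]
  have hXpos : 0 < X := lt_of_le_of_lt (by positivity) hcon
  have h6 := mul_lt_mul_of_pos_right hcon hXpos
  nlinarith [mul_le_mul_of_nonneg_left hXT (mul_nonneg hβ0 hT0), mul_nonneg hT0 hX0]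

/-! ### The Sobolev inequality for piecewise constant functions on a polygonal domain -/

lemma sum_measureReal_le {E : Type} {s : Finset E} {H : E → Set Plane} {S : Set Plane}
    (hS : volume S ≠ ⊤) (hH : ∀ e ∈ s, MeasurableSet (H e)) (hHS : ∀ e ∈ s, H e ⊆ S)
    (hd : (s : Set E).PairwiseDisjoint H) : ∑ e ∈ s, volume.real (H e) ≤ volume.real S := by
  rw [← measureReal_biUnion_finset hd hH
    (fun e he => ne_top_of_le_ne_top hS (measure_mono (hHS e he)))]
  exact measureReal_mono (iUnion₂_subset hHS) hS

/-- Discrete Sobolev inequality for a partition `A` of a polygonal domain, with disjoint diamonds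
`D e` around the interfaces. One of the two halves `D e ∩ A (l e)`, `D e ∩ A (r e)` of each diamond
is required to have an area comparable to the product of the lengths of the diagonals. -/
theorem IsPolygonalDomain.exists_sobolev {Ω : Set Plane} (hΩ : IsPolygonalDomain Ω) {κ : ℝ}
    (hκ : 0 ≤ κ) : ∃ K : ℝ, 0 ≤ K ∧ ∀ {ι E : Type} [Fintype ι] [Fintype E] {A : ι → Set Plane}
      {a b : E → Plane} {l r : E → ι} {D : E → Set Plane} {dlen G : E → ℝ} {g : ι → ℝ},
      IsInterface Ω A a b l r → (∀ e, D e ⊆ Ω) → Pairwise (Function.onFun Disjoint D) →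
      (∀ e, ∃ H, MeasurableSet H ∧ H ⊆ D e ∧ (H ⊆ A (l e) ∨ H ⊆ A (r e)) ∧
        dist (a e) (b e) * dlen e ≤ κ * volume.real H) →
      (∀ e, 0 ≤ dlen e) → (∀ e, dlen e ≤ Metric.diam (closure Ω)) → (∀ i, 0 ≤ g i) →
      (∀ e, |g (l e) - g (r e)| ≤ dlen e * G e) →
      ∃ c, 0 ≤ c ∧ √(∑ i, volume.real (A i) * (g i - c) ^ 4) ≤
        K * ∑ e, volume.real (D e) * G e ^ 2 := by
  obtain ⟨C, hC⟩ := hΩ.exists_hasPoincare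
  have hfin : volume Ω ≠ ⊤ := hΩ.isBounded.measure_lt_top.ne
  refine ⟨8 * |C| * κ ^ 2 * √(volume.real Ω) + 2 * |C| * κ ^ 2 * Metric.diam (closure Ω) ^ 2 + 1,
    by positivity, ?_⟩
  intro ι E _ _ A a b l r D dlen G g hA hDΩ hDd hH hdlen hd hg hdiff
  classical
  choose H hHm hHD hHA hHκ using hH
  have hAfin : ∀ i, volume (A i) ≠ ⊤ := fun i =>
    ne_top_of_le_ne_top hfin (measure_mono (hA.partition.subset i))
  refine exists_sqrt_sum_pow_four_le (l := l) (r := r) (len := fun e => dist (a e) (b e))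
    (side := fun e => if H e ⊆ A (l e) then l e else r e)
    (τ := fun e => volume.real (H e)) ?_ (abs_nonneg C) hκ (fun _ => measureReal_nonneg) hg
    (fun _ => dist_nonneg) hdlen (fun _ => measureReal_nonneg) hdiff ?_ ?_ hHκ ?_ hd ?_
  · intro u
    obtain ⟨c, hc⟩ := hC A a b l r hA u
    refine ⟨c, ?_⟩
    simp only [inter_eq_self_of_subset_left (hA.partition.subset _)] at hc
    exact hc.trans (mul_le_mul_of_nonneg_right (le_abs_self C) (sq_nonneg _))
  · intro e
    refine (hHκ e).trans (mul_le_mul_of_nonneg_left (measureReal_mono (hHD e) ?_) hκ)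
    exact ne_top_of_le_ne_top hfin (measure_mono (hDΩ e))
  · intro e
    split_ifs
    · exact Or.inl rfl
    · exact Or.inr rfl
  · intro i
    refine sum_measureReal_le (hAfin i) (fun e _ => hHm e) (fun e he => ?_) ?_
    · rw [← (Finset.mem_filter.1 he).2]
      split_ifs with h
      · exact h
      · exact (hHA e).resolve_left h
    · intro e _ e' _ hee
      exact (hDd hee).mono (hHD e) (hHD e')
  · refine sum_measureReal_le hfin (fun i _ => (hA.partition.isOpen i).measurableSet)
      (fun i _ => hA.partition.subset i) ?_
    intro i _ j _ hij
    exact hA.partition.disjoint i j hij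

lemma IsPartition.volume_diff_eq_zero {Ω : Set Plane} {ι : Type} [Countable ι] {A : ι → Set Plane}
    (hA : IsPartition Ω A) (h : ∀ i, volume (frontier (A i)) = 0) :
    volume (Ω \ ⋃ i, A i) = 0 := by
  refine measure_mono_null ?_ (measure_iUnion_null h)
  rintro z ⟨hz, hz'⟩
  have := subset_closure hz
  rw [← hA.cover, mem_iUnion] at this
  obtain ⟨i, hi⟩ := this
  refine mem_iUnion.2 ⟨i, ?_⟩
  rw [(hA.isOpen i).frontier_eq]
  exact ⟨hi, fun h => hz' (mem_iUnion.2 ⟨i, h⟩)⟩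

lemma IsPartition.mem_frontier {Ω : Set Plane} {ι : Type} {A : ι → Set Plane}
    (hA : IsPartition Ω A) {i j : ι} (hij : i ≠ j) {z : Plane} (hi : z ∈ closure (A i))
    (hj : z ∈ closure (A j)) : z ∈ frontier (A i) := by
  rw [(hA.isOpen i).frontier_eq]
  exact ⟨hi, fun h => (((hA.disjoint i j hij).closure_right (hA.isOpen i)).le_bot ⟨h, hj⟩)⟩

/-! ### The discrete gradient -/

lemma sin_angle_mul_norm (x y : Plane) :
    Real.sin (InnerProductGeometry.angle x y) * (‖x‖ * ‖y‖) = |cross x y| := by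
  rw [InnerProductGeometry.sin_angle_mul_norm_mul_norm, ← Real.sqrt_sq_eq_abs]
  congr 1
  have := cross_sq_add_inner_sq x y
  rw [real_inner_self_eq_norm_sq, real_inner_self_eq_norm_sq]
  linarith

lemma inner_unitNormal_left (t d : Plane) : inner ℝ (unitNormal t d) t = 0 := by
  rcases eq_or_ne t 0 with rfl | ht
  · simp
  rw [unitNormal, real_inner_smul_left, inner_sub_left, real_inner_smul_left, real_inner_comm t d,
    div_mul_cancel₀ _ (inner_self_ne_zero.2 ht), sub_self, mul_zero]

lemma inner_unitNormal_right {t d : Plane} (h : cross d t ≠ 0) :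
    inner ℝ (unitNormal t d) d = Real.sin (InnerProductGeometry.angle d t) * ‖d‖ := by
  set c := (inner ℝ t d / inner ℝ t t : ℝ) with hc
  set p := d - c • t with hp
  have ht : t ≠ 0 := by rintro rfl; simp [cross] at h
  have hpt : inner ℝ p t = 0 := by
    rw [hp, inner_sub_left, real_inner_smul_left, hc, real_inner_comm t d,
      div_mul_cancel₀ _ (inner_self_ne_zero.2 ht), sub_self]
  have hcr : cross p t = cross d t := by simp [hp, cross]; ring
  have h1 : ‖p‖ * ‖t‖ = |cross d t| := by
    have := cross_sq_add_inner_sq p t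
    rw [hpt, hcr, ← mul_pow] at this
    rw [← Real.sqrt_sq_eq_abs, ← Real.sqrt_sq (by positivity : 0 ≤ ‖p‖ * ‖t‖)]
    congr 1
    linarith
  have hp0 : ‖p‖ ≠ 0 := by
    intro h0
    rw [h0, zero_mul] at h1
    exact h (abs_eq_zero.1 h1.symm)
  have hpd : inner ℝ p d = ‖p‖ ^ 2 := by
    calc (inner ℝ p d : ℝ) = inner ℝ p (p + c • t) := by rw [hp, sub_add_cancel]
      _ = ‖p‖ ^ 2 := by
        rw [inner_add_right, real_inner_smul_right, hpt, real_inner_self_eq_norm_sq]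
        ring
  have h2 : inner ℝ (unitNormal t d) d = ‖p‖ := by
    rw [unitNormal, real_inner_smul_left]
    change ‖p‖⁻¹ * inner ℝ p d = ‖p‖
    rw [hpd]
    field_simp
  rw [h2]
  have h3 := sin_angle_mul_norm d t
  have ht' : ‖t‖ ≠ 0 := norm_ne_zero_iff.2 ht
  apply mul_right_cancel₀ ht'
  rw [h1, mul_assoc, h3]

namespace MeshData

variable {M : MeshData} {Ω : Set Plane}

/-! ### Geometry of the diamonds -/

/-- The determinant of the two diagonals `σ*` and `σ` of a diamond, that is, up to sign,
`m_σ m_{σ*} sin α`. -/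
def diagCross (M : MeshData) (σ : M.Edge) : ℝ := cross (M.xL σ - M.xK σ) (M.xB σ - M.xA σ)

/-- The line through `x_K` and `x_L` meets the edge in its interior, before or at `x_L`. -/
lemma IsMesh.exists_crossing (hM : M.IsMesh Ω) (σ : M.Edge) : ∃ r c : ℝ, 0 < r ∧ r ≤ 1 ∧ 0 < c ∧
    c < 1 ∧ r • (M.xL σ - M.xK σ) = (1 - c) • (M.xA σ - M.xK σ) + c • (M.xB σ - M.xK σ) := by
  rcases σ with e | e
  · obtain ⟨w, hw, hw'⟩ := hM.diagonals_cross e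
    rw [openSegment_eq_image] at hw hw'
    obtain ⟨c, hc, rfl⟩ := hw
    obtain ⟨r, hr, hrc⟩ := hw'
    refine ⟨r, c, hr.1, hr.2.le, hc.1, hc.2, ?_⟩
    simp only at hrc
    have h1 : r • (M.xL (.inl e) - M.xK (.inl e)) =
        ((1 - r) • M.xK (.inl e) + r • M.xL (.inl e)) - M.xK (.inl e) := by module
    rw [h1, hrc]
    module
  · refine ⟨1, 1 / 2, by norm_num, le_rfl, by norm_num, by norm_num, ?_⟩
    have : M.xL (.inr e) = midpoint ℝ (M.xA (.inr e)) (M.xB (.inr e)) := rfl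
    rw [this, midpoint_eq_smul_add, invOf_eq_inv]
    module

lemma IsMesh.cross_near_ne_zero (hM : M.IsMesh Ω) (σ : M.Edge) :
    cross (M.xA σ - M.xK σ) (M.xB σ - M.xK σ) ≠ 0 := by
  have := cross_ne_zero_of_affineIndependent (hM.nondegenerate σ)
  convert this using 1
  simp [cross]; ring

lemma IsMesh.diagCross_ne_zero (hM : M.IsMesh Ω) (σ : M.Edge) : M.diagCross σ ≠ 0 := by
  obtain ⟨r, c, -, -, -, -, h⟩ := hM.exists_crossing σ
  intro h0
  apply hM.cross_near_ne_zero σ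
  have h1 : cross (r • (M.xL σ - M.xK σ)) (M.xB σ - M.xA σ) = 0 := by
    rw [cross_smul_left]
    exact mul_eq_zero_of_right _ h0
  rw [h] at h1
  rw [← h1]
  simp [cross]; ring

lemma sinAngle_mul (M : MeshData) (σ : M.Edge) :
    M.sinAngle σ * (M.mDualEdge σ * M.mEdge σ) = |M.diagCross σ| := by
  rw [sinAngle, mDualEdge, mEdge, dist_comm, dist_comm (M.xA σ), dist_eq_norm, dist_eq_norm,
    sin_angle_mul_norm, diagCross]

lemma IsMesh.lengths_pos (hM : M.IsMesh Ω) (σ : M.Edge) :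
    0 < M.sinAngle σ ∧ 0 < M.mDualEdge σ ∧ 0 < M.mEdge σ := by
  have h1 : M.sinAngle σ * (M.mDualEdge σ * M.mEdge σ) ≠ 0 := by
    rw [sinAngle_mul]; exact abs_ne_zero.2 (hM.diagCross_ne_zero σ)
  have h2 := mul_ne_zero_iff.1 h1
  have h3 := mul_ne_zero_iff.1 h2.2
  exact ⟨lt_of_le_of_ne (InnerProductGeometry.sin_angle_nonneg _ _) h2.1.symm,
    lt_of_le_of_ne dist_nonneg h3.1.symm, lt_of_le_of_ne dist_nonneg h3.2.symm⟩

/-- Regularity bounds the angle of the diagonals from below. -/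
lemma IsMesh.mul_lengths_le (hM : M.IsMesh Ω) {Θ : ℝ} (hΘ : M.IsRegular Ω Θ) (σ : M.Edge) :
    M.mEdge σ * M.mDualEdge σ ≤ Θ * |M.diagCross σ| := by
  obtain ⟨hs, hd, he⟩ := hM.lengths_pos σ
  have h := (hΘ σ).1
  rw [theta] at h
  have h2 : 2 ≤ M.mEdge σ / M.mDualEdge σ + M.mDualEdge σ / M.mEdge σ := by
    rw [div_add_div _ _ hd.ne' he.ne', le_div_iff₀ (by positivity)]
    nlinarith [sq_nonneg (M.mEdge σ - M.mDualEdge σ)]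
  have h3 : 1 ≤ Θ * M.sinAngle σ := by
    have : 1 / (2 * M.sinAngle σ) * 2 ≤ Θ :=
      (mul_le_mul_of_nonneg_left h2 (by positivity)).trans h
    rwa [one_div_mul_eq_div, div_le_iff₀ (by positivity), mul_left_comm,
      le_mul_iff_one_le_right (by norm_num)] at this
  rw [← sinAngle_mul]
  nlinarith [mul_pos hd he]

lemma IsMesh.inner_grad_dual (hM : M.IsMesh Ω) (u : M.Index → ℝ) (σ : M.Edge) :
    inner ℝ (M.grad u σ) (M.xL σ - M.xK σ) =
      u (.inl (M.opp σ)) - u (.inl (.inl (M.near σ))) := by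
  obtain ⟨hs, hd, he⟩ := hM.lengths_pos σ
  have h1 : ‖M.xL σ - M.xK σ‖ = M.mDualEdge σ := by rw [mDualEdge, dist_comm, dist_eq_norm]
  rw [grad, real_inner_smul_left, inner_add_left, real_inner_smul_left, real_inner_smul_left,
    inner_unitNormal_left, inner_unitNormal_right (hM.diagCross_ne_zero σ), h1, mul_zero, add_zero]
  change 1 / M.sinAngle σ * (_ * (M.sinAngle σ * M.mDualEdge σ)) = _
  field_simp

lemma IsMesh.inner_grad_edge (hM : M.IsMesh Ω) (u : M.Index → ℝ) (σ : M.Edge) :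
    inner ℝ (M.grad u σ) (M.xB σ - M.xA σ) =
      u (.inr (M.vtxB σ)) - u (.inr (M.vtxA σ)) := by
  obtain ⟨hs, hd, he⟩ := hM.lengths_pos σ
  have h1 : ‖M.xB σ - M.xA σ‖ = M.mEdge σ := by rw [mEdge, dist_comm, dist_eq_norm]
  have h2 : cross (M.xB σ - M.xA σ) (M.xL σ - M.xK σ) ≠ 0 := by
    convert neg_ne_zero.2 (hM.diagCross_ne_zero σ) using 1
    simp [diagCross, cross]; ring
  rw [grad, real_inner_smul_left, inner_add_left, real_inner_smul_left, real_inner_smul_left,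
    inner_unitNormal_left, inner_unitNormal_right h2, h1, mul_zero, zero_add,
    InnerProductGeometry.angle_comm]
  change 1 / M.sinAngle σ * (_ * (M.sinAngle σ * M.mEdge σ)) = _
  field_simp

lemma IsMesh.abs_primal_sub_le (hM : M.IsMesh Ω) (u : M.Index → ℝ) (σ : M.Edge) :
    |u (.inl (M.opp σ)) - u (.inl (.inl (M.near σ)))| ≤ M.mDualEdge σ * ‖M.grad u σ‖ := by
  rw [← hM.inner_grad_dual, mul_comm, mDualEdge, dist_comm, dist_eq_norm]
  exact abs_real_inner_le_norm _ _

lemma IsMesh.abs_dual_sub_le (hM : M.IsMesh Ω) (u : M.Index → ℝ) (σ : M.Edge) :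
    |u (.inr (M.vtxB σ)) - u (.inr (M.vtxA σ))| ≤ M.mEdge σ * ‖M.grad u σ‖ := by
  rw [← hM.inner_grad_edge, mul_comm, mEdge, dist_comm, dist_eq_norm]
  exact abs_real_inner_le_norm _ _

lemma measureReal_halfPara (P A B : Plane) :
    volume.real (halfPara P A B) = |cross (A - P) (B - P)| / 4 := by
  rw [measureReal_def, halfPara, volume_para, cross_half, ENNReal.toReal_ofReal (abs_nonneg _),
    abs_div, abs_of_pos (by norm_num : (0 : ℝ) < 4)]

lemma halfPara_subset_diamond {σ : M.Edge} {P A B : Plane} (h : cross (A - P) (B - P) ≠ 0)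
    (hsub : ({P, A, B} : Set Plane) ⊆ {M.xK σ, M.xL σ, M.xA σ, M.xB σ}) :
    halfPara P A B ⊆ M.diamond σ :=
  halfPara_subset_interior h (convexHull_mono hsub)

lemma IsMesh.convexHull_subset_closure_diamond (hM : M.IsMesh Ω) (σ : M.Edge) :
    convexHull ℝ {M.xK σ, M.xL σ, M.xA σ, M.xB σ} ⊆ closure (M.diamond σ) := by
  rw [diamond, Convex.closure_interior_eq_closure_of_nonempty_interior (convex_convexHull ℝ _)]
  · exact subset_closure
  · have h : (halfPara (M.xK σ) (M.xA σ) (M.xB σ)).Nonempty :=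
      ⟨_, ⟨(1 / 2, 1 / 2), by norm_num, rfl⟩⟩
    exact h.mono (halfPara_subset_diamond (hM.cross_near_ne_zero σ) (by grind))

lemma IsMesh.eq_of_mem_diamond (hM : M.IsMesh Ω) {σ σ' : M.Edge} {z : Plane}
    (hz : z ∈ M.diamond σ) (hz' : z ∈ closure (M.diamond σ')) : σ = σ' := by
  by_contra hne
  exact ((hM.diamond_partition.disjoint σ σ' hne).closure_right
    (hM.diamond_partition.isOpen σ)).le_bot ⟨hz, hz'⟩

lemma IsMesh.edgeSeg_subset (hM : M.IsMesh Ω) (σ : M.Edge) :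
    M.edgeSeg σ ⊆ closure (M.diamond σ) := by
  refine Subset.trans ?_ (hM.convexHull_subset_closure_diamond σ)
  rw [edgeSeg, ← convexHull_pair]
  exact convexHull_mono (by grind)

/-- Inside `Ω`, dual edges can meet only at their endpoints, because they lie in disjoint diamonds. -/
lemma IsMesh.openSegment_dual_subset (hM : M.IsMesh Ω) (σ : M.Edge) :
    openSegment ℝ (M.xK σ) (M.xL σ) ⊆ M.diamond σ := by
  intro z hz
  rw [openSegment_eq_image] at hz
  obtain ⟨t, ht, rfl⟩ := hz
  obtain ⟨r, c, hr, hr1, hc, hc1, h⟩ := hM.exists_crossing σ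
  -- a point of the dual edge close to `x_K` lies in the half-parallelogram at `x_K`
  set q := min t r / 2 with hq
  have hq0 : 0 < q := by have := lt_min ht.1 hr; positivity
  have hqt : q < t := by have := min_le_left t r; linarith [ht.1]
  have hqr : q ≤ r / 2 := by have := min_le_right t r; linarith
  have hqr' : q / r ≤ 1 / 2 := by rw [div_le_iff₀ hr]; linarith
  have hqr0 : 0 < q / r := by positivity
  have hz1 : M.xK σ + q • (M.xL σ - M.xK σ) ∈ M.diamond σ := by
    apply halfPara_subset_diamond (P := M.xK σ) (A := M.xA σ) (B := M.xB σ)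
      (hM.cross_near_ne_zero σ) (by grind)
    refine ⟨(2 * (q / r * (1 - c)), 2 * (q / r * c)),
      ⟨⟨by have := sub_pos.2 hc1; positivity, by nlinarith⟩, ⟨by positivity, by nlinarith⟩⟩, ?_⟩
    have : q • (M.xL σ - M.xK σ) = (q / r) • (r • (M.xL σ - M.xK σ)) := by
      rw [smul_smul, div_mul_cancel₀ _ hr.ne']
    rw [this, h]
    simp only [paraMap]
    module
  refine (convex_convexHull ℝ _).openSegment_interior_self_subset_interior hz1
    (subset_convexHull ℝ _ (show M.xL σ ∈ _ by simp)) ?_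
  rw [openSegment_eq_image]
  have h1 : 0 < 1 - q := by linarith [ht.2]
  refine ⟨(t - q) / (1 - q), ⟨div_pos (by linarith) h1, ?_⟩, ?_⟩
  · rw [div_lt_one h1]; linarith [ht.2]
  · have : (1 - q)⁻¹ * (1 - q) = 1 := inv_mul_cancel₀ h1.ne'
    have h2 : 1 - (t - q) / (1 - q) = (1 - t) * (1 - q)⁻¹ := by field_simp; ring
    have h3 : M.xK σ + q • (M.xL σ - M.xK σ) = (1 - q) • M.xK σ + q • M.xL σ := by module
    simp only
    rw [h2, h3, smul_add, smul_smul, smul_smul, mul_assoc, this, mul_one, add_assoc, ← add_smul]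
    congr 2
    field_simp
    ring

/-! ### The primal mesh -/

lemma IsMesh.edgeSeg_subset_closure (hM : M.IsMesh Ω) (σ : M.Edge) : M.edgeSeg σ ⊆ closure Ω := by
  have h : M.edgeSeg σ ⊆ frontier (M.cell (M.near σ)) := by
    rw [hM.frontier_cell]
    exact subset_biUnion_of_mem (u := M.edgeSeg)
      (show σ ∈ {σ | M.IsEdgeOf σ (M.near σ)} from Or.inl rfl)
  exact h.trans (frontier_subset_closure.trans
    (closure_mono (hM.primal_partition.subset (M.near σ))))

lemma IsMesh.lengths_le_diam (hM : M.IsMesh Ω) (hΩ : Bornology.IsBounded Ω) (σ : M.Edge) :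
    M.mEdge σ ≤ Metric.diam (closure Ω) ∧ M.mDualEdge σ ≤ Metric.diam (closure Ω) := by
  have hc : ∀ K, M.center K ∈ closure Ω := fun K =>
    subset_closure (hM.primal_partition.subset K (hM.center_mem K))
  refine ⟨Metric.dist_le_diam_of_mem hΩ.closure
    (hM.edgeSeg_subset_closure σ (left_mem_segment ℝ _ _))
    (hM.edgeSeg_subset_closure σ (right_mem_segment ℝ _ _)),
    Metric.dist_le_diam_of_mem hΩ.closure (hc _) ?_⟩
  rcases σ with e | e
  · exact hc _
  · exact hM.edgeSeg_subset_closure (.inr e) (midpoint_mem_segment _ _)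

/-- The half-parallelogram at the center of a cell towards one of its edges lies in the cell: it is
connected, has the center in its closure and cannot meet the boundary of the cell, since it lies
inside the diamond of the edge, which meets no other edge, and strictly on one side of the edge. -/
lemma IsMesh.halfPara_subset_cell (hM : M.IsMesh Ω) {σ : M.Edge} {K : M.Cell}
    (h : cross (M.xA σ - M.center K) (M.xB σ - M.center K) ≠ 0)
    (hD : halfPara (M.center K) (M.xA σ) (M.xB σ) ⊆ M.diamond σ) :
    halfPara (M.center K) (M.xA σ) (M.xB σ) ⊆ M.cell K := by
  have hKo := hM.primal_partition.isOpen K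
  refine (convex_para _ _ _).isPreconnected.subset_of_closure_inter_subset hKo ?_ ?_
  · have hc : M.center K ∈ closure (halfPara (M.center K) (M.xA σ) (M.xB σ)) := by
      have := mem_closure_halfPara (P := M.center K) (A := M.xA σ) (B := M.xB σ) le_rfl le_rfl
        (by norm_num : (0 : ℝ) ≤ 1 / 2) (by norm_num : (0 : ℝ) ≤ 1 / 2)
      simpa using this
    rw [inter_comm]
    exact mem_closure_iff.1 hc _ hKo (hM.center_mem K)
  · rintro z ⟨hzK, hz⟩
    by_contra hzn
    have hzf : z ∈ frontier (M.cell K) := by rw [hKo.frontier_eq]; exact ⟨hzK, hzn⟩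
    rw [hM.frontier_cell] at hzf
    obtain ⟨σ', -, hzσ'⟩ := mem_iUnion₂.1 hzf
    obtain rfl := hM.eq_of_mem_diamond (hD hz) (hM.edgeSeg_subset σ' hzσ')
    obtain ⟨s, t, -, -, hs, ht, hst⟩ := mem_halfPara hz
    rw [edgeSeg, segment_eq_image] at hzσ'
    obtain ⟨c, -, hcz⟩ := hzσ'
    simp only at hcz
    rw [← hcz] at hst
    have h1 : cross ((1 - c) • M.xA σ + c • M.xB σ - M.xA σ) (M.xB σ - M.xA σ) = 0 := by
      simp [cross]; ring
    rw [hst] at h1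
    have h2 : (1 - s - t) * cross (M.xA σ - M.center K) (M.xB σ - M.center K) = 0 := by
      rw [← neg_eq_zero, ← h1]
      simp [cross]; ring
    rcases mul_eq_zero.1 h2 with h3 | h3
    · linarith
    · exact h h3

lemma IsMesh.volume_frontier_cell (hM : M.IsMesh Ω) (K : M.Cell) :
    volume (frontier (M.cell K)) = 0 := by
  rw [hM.frontier_cell]
  exact (measure_biUnion_null_iff (to_countable _)).2 fun σ _ => volume_segment _ _

lemma IsMesh.isInterface_primal (hM : M.IsMesh Ω) :
    IsInterface Ω M.cell (fun e : M.IntEdge => M.xA (.inl e)) (fun e => M.xB (.inl e))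
      (fun e => M.near (.inl e)) (fun e => M.far e) where
  partition := hM.primal_partition
  null := hM.primal_partition.volume_diff_eq_zero hM.volume_frontier_cell
  separated := by
    refine ⟨range M.pt, finite_range _, ?_⟩
    intro i j z hij _ hzF hzi hzj
    have hi := hM.primal_partition.mem_frontier hij hzi hzj
    have hj := hM.primal_partition.mem_frontier hij.symm hzj hzi
    rw [hM.frontier_cell] at hi hj
    obtain ⟨σ, hσ, hzσ⟩ := mem_iUnion₂.1 hi
    obtain ⟨σ', hσ', hzσ'⟩ := mem_iUnion₂.1 hj
    have hne : ∀ a, M.pt a ≠ z := fun a h => hzF ⟨a, h⟩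
    have hz0 := mem_openSegment_of_ne_left_right (hne _) (hne _) hzσ
    obtain rfl : σ = σ' := by
      by_contra hne'
      exact (hM.edge_disjoint σ σ' hne').le_bot ⟨hz0, hzσ'⟩
    rcases σ with e | e
    · refine ⟨e, hzσ, ?_⟩
      have h1 : M.near (.inl e) = i ∨ M.opp (.inl e) = .inl i := hσ
      have h2 : M.near (.inl e) = j ∨ M.opp (.inl e) = .inl j := hσ'
      simp only [opp, Sum.inl.injEq] at h1 h2
      grind
    · have h1 : M.near (.inr e) = i ∨ M.opp (.inr e) = .inl i := hσ
      have h2 : M.near (.inr e) = j ∨ M.opp (.inr e) = .inl j := hσ'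
      simp only [opp, reduceCtorEq, or_false] at h1 h2
      exact absurd (h1.symm.trans h2) hij

/-! ### The dual mesh -/

lemma halfPara_subset_dualCell {σ : M.Edge} {a : M.Vertex} (ha : M.IsEndOf a σ)
    (h : cross (M.xK σ - M.pt a) (M.xL σ - M.pt a) ≠ 0) :
    halfPara (M.pt a) (M.xK σ) (M.xL σ) ⊆ M.dualCell a :=
  halfPara_subset_interior h (subset_biUnion_of_mem
    (u := fun σ => convexHull ℝ {M.pt a, M.xK σ, M.xL σ}) (show σ ∈ {σ | M.IsEndOf a σ} from ha))

lemma segment_pt_midpoint_subset {a : M.Vertex} {e : M.BdryEdge} (ha : M.IsEndOf a (.inr e)) :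
    segment ℝ (M.pt a) (M.xL (.inr e)) ⊆ M.edgeSeg (.inr e) := by
  refine (convex_segment _ _).segment_subset ?_ (midpoint_mem_segment _ _)
  rcases ha with rfl | rfl
  · exact left_mem_segment ℝ _ _
  · exact right_mem_segment ℝ _ _

lemma IsMesh.volume_frontier_dualCell (hM : M.IsMesh Ω) (a : M.Vertex) :
    volume (frontier (M.dualCell a)) = 0 := by
  rw [hM.frontier_dualCell]
  refine measure_union_null ?_ ?_
  · exact (measure_biUnion_null_iff (to_countable _)).2 fun σ _ => volume_segment _ _
  · exact (measure_biUnion_null_iff (to_countable _)).2 fun σ _ => volume_segment _ _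

lemma IsMesh.exists_dualSeg (hM : M.IsMesh Ω) (hΩ : IsOpen Ω) {a : M.Vertex} {z : Plane}
    (hzΩ : z ∈ Ω) (hz : z ∈ frontier (M.dualCell a)) : ∃ σ, M.IsEndOf a σ ∧ z ∈ M.dualSeg σ := by
  rw [hM.frontier_dualCell] at hz
  rcases hz with hz | hz
  · obtain ⟨σ, hσ, hzσ⟩ := mem_iUnion₂.1 hz
    exact ⟨σ, hσ, hzσ⟩
  · obtain ⟨e, he, hze⟩ := mem_iUnion₂.1 hz
    have := hM.boundary_edge e (segment_pt_midpoint_subset he hze)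
    rw [hΩ.frontier_eq] at this
    exact absurd hzΩ this.2

lemma IsMesh.isInterface_dual (hM : M.IsMesh Ω) (hΩ : IsOpen Ω) :
    IsInterface Ω M.dualCell M.xK M.xL M.vtxA M.vtxB where
  partition := hM.dual_partition
  null := hM.dual_partition.volume_diff_eq_zero hM.volume_frontier_dualCell
  separated := by
    refine ⟨range M.primalCenter, finite_range _, ?_⟩
    intro i j z hij hzΩ hzF hzi hzj
    obtain ⟨σ, hσ, hzσ⟩ := hM.exists_dualSeg hΩ hzΩ
      (hM.dual_partition.mem_frontier hij hzi hzj)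
    obtain ⟨σ', hσ', hzσ'⟩ := hM.exists_dualSeg hΩ hzΩ
      (hM.dual_partition.mem_frontier hij.symm hzj hzi)
    have hne : ∀ a, M.primalCenter a ≠ z := fun a h => hzF ⟨a, h⟩
    have hopen : ∀ σ, z ∈ M.dualSeg σ → z ∈ M.diamond σ := fun σ h =>
      hM.openSegment_dual_subset σ
        (mem_openSegment_of_ne_left_right (hne (.inl (M.near σ))) (hne _) h)
    obtain rfl := hM.eq_of_mem_diamond (hopen σ hzσ) (subset_closure (hopen σ' hzσ'))
    refine ⟨σ, hzσ, ?_⟩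
    have h1 : M.vtxA σ = i ∨ M.vtxB σ = i := hσ
    have h2 : M.vtxA σ = j ∨ M.vtxB σ = j := hσ'
    grind

/-! ### The larger half of a diamond -/

/-- Cutting a quadrilateral with diagonals `P Q` and `A B` along `A B`, one of the two triangles has
at least half of the area. -/
lemma half_abs_cross_le (P Q A B : Plane) :
    |cross (Q - P) (B - A)| / 2 ≤ |cross (A - P) (B - P)| ∨
      |cross (Q - P) (B - A)| / 2 ≤ |cross (A - Q) (B - Q)| := by
  have h : cross (Q - P) (B - A) = cross (A - P) (B - P) - cross (A - Q) (B - Q) := by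
    simp [cross]; ring
  by_contra! hcon
  have := abs_sub (cross (A - P) (B - P)) (cross (A - Q) (B - Q))
  rw [← h] at this
  linarith [hcon.1, hcon.2]

lemma IsMesh.mul_lengths_le_halfPara (hM : M.IsMesh Ω) {Θ : ℝ} (hΘ0 : 0 ≤ Θ)
    (hΘ : M.IsRegular Ω Θ) {σ : M.Edge} {P A B : Plane}
    (h : |M.diagCross σ| / 2 ≤ |cross (A - P) (B - P)|) :
    M.mEdge σ * M.mDualEdge σ ≤ 8 * Θ * volume.real (halfPara P A B) := by
  refine (hM.mul_lengths_le hΘ σ).trans ?_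
  rw [measureReal_halfPara]
  nlinarith

/-- The larger of the two parts of a diamond cut by its edge contains a piece of comparable area in
the adjacent cell. -/
lemma IsMesh.exists_piece_primal (hM : M.IsMesh Ω) {Θ : ℝ} (hΘ0 : 0 ≤ Θ) (hΘ : M.IsRegular Ω Θ)
    (e : M.IntEdge) : ∃ H, MeasurableSet H ∧ H ⊆ M.diamond (.inl e) ∧
      (H ⊆ M.cell (M.near (.inl e)) ∨ H ⊆ M.cell (M.far e)) ∧
      M.mEdge (.inl e) * M.mDualEdge (.inl e) ≤ 8 * Θ * volume.real H := by
  have key : ∀ K, ({M.center K, M.xA (.inl e), M.xB (.inl e)} : Set Plane) ⊆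
      {M.xK (.inl e), M.xL (.inl e), M.xA (.inl e), M.xB (.inl e)} →
      |M.diagCross (.inl e)| / 2 ≤
        |cross (M.xA (.inl e) - M.center K) (M.xB (.inl e) - M.center K)| →
      ∃ H, MeasurableSet H ∧ H ⊆ M.diamond (.inl e) ∧ H ⊆ M.cell K ∧
        M.mEdge (.inl e) * M.mDualEdge (.inl e) ≤ 8 * Θ * volume.real H := by
    intro K hK hle
    have hne : cross (M.xA (.inl e) - M.center K) (M.xB (.inl e) - M.center K) ≠ 0 := by
      have := abs_pos.2 (hM.diagCross_ne_zero (.inl e))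
      exact abs_pos.1 (by linarith)
    have hD := halfPara_subset_diamond hne hK
    exact ⟨_, (isOpen_halfPara hne).measurableSet, hD, hM.halfPara_subset_cell hne hD,
      hM.mul_lengths_le_halfPara hΘ0 hΘ hle⟩
  rcases half_abs_cross_le (M.xK (.inl e)) (M.xL (.inl e)) (M.xA (.inl e)) (M.xB (.inl e))
    with h | h
  · obtain ⟨H, h1, h2, h3, h4⟩ := key (M.near (.inl e))
      (show ({M.xK (.inl e), M.xA (.inl e), M.xB (.inl e)} : Set Plane) ⊆ _ by grind) h
    exact ⟨H, h1, h2, Or.inl h3, h4⟩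
  · obtain ⟨H, h1, h2, h3, h4⟩ := key (M.far e)
      (show ({M.xL (.inl e), M.xA (.inl e), M.xB (.inl e)} : Set Plane) ⊆ _ by grind) h
    exact ⟨H, h1, h2, Or.inr h3, h4⟩

/-- The larger of the two parts of a diamond cut by its dual edge contains a piece of comparable
area in the adjacent dual cell. -/
lemma IsMesh.exists_piece_dual (hM : M.IsMesh Ω) {Θ : ℝ} (hΘ0 : 0 ≤ Θ) (hΘ : M.IsRegular Ω Θ)
    (σ : M.Edge) : ∃ H, MeasurableSet H ∧ H ⊆ M.diamond σ ∧
      (H ⊆ M.dualCell (M.vtxA σ) ∨ H ⊆ M.dualCell (M.vtxB σ)) ∧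
      M.mDualEdge σ * M.mEdge σ ≤ 8 * Θ * volume.real H := by
  have key : ∀ a, M.IsEndOf a σ →
      ({M.pt a, M.xK σ, M.xL σ} : Set Plane) ⊆ {M.xK σ, M.xL σ, M.xA σ, M.xB σ} →
      |M.diagCross σ| / 2 ≤ |cross (M.xK σ - M.pt a) (M.xL σ - M.pt a)| →
      ∃ H, MeasurableSet H ∧ H ⊆ M.diamond σ ∧ H ⊆ M.dualCell a ∧
        M.mDualEdge σ * M.mEdge σ ≤ 8 * Θ * volume.real H := by
    intro a ha hsub hle
    have hne : cross (M.xK σ - M.pt a) (M.xL σ - M.pt a) ≠ 0 := by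
      have := abs_pos.2 (hM.diagCross_ne_zero σ)
      exact abs_pos.1 (by linarith)
    rw [mul_comm (M.mDualEdge σ)]
    exact ⟨_, (isOpen_halfPara hne).measurableSet, halfPara_subset_diamond hne hsub,
      halfPara_subset_dualCell ha hne, hM.mul_lengths_le_halfPara hΘ0 hΘ hle⟩
  have hcomm : |cross (M.xB σ - M.xA σ) (M.xL σ - M.xK σ)| = |M.diagCross σ| := by
    rw [← abs_neg]
    congr 1
    simp [diagCross, cross]; ring
  rcases half_abs_cross_le (M.xA σ) (M.xB σ) (M.xK σ) (M.xL σ) with h | h <;> rw [hcomm] at h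
  · obtain ⟨H, h1, h2, h3, h4⟩ := key (M.vtxA σ) (Or.inl rfl)
      (show ({M.xA σ, M.xK σ, M.xL σ} : Set Plane) ⊆ _ by grind) h
    exact ⟨H, h1, h2, Or.inl h3, h4⟩
  · obtain ⟨H, h1, h2, h3, h4⟩ := key (M.vtxB σ) (Or.inr rfl)
      (show ({M.xB σ, M.xK σ, M.xL σ} : Set Plane) ⊆ _ by grind) h
    exact ⟨H, h1, h2, Or.inr h3, h4⟩

lemma le_supValue_cell (u : M.Index → ℝ) (K : M.Cell) : u (.inl (.inl K)) ≤ M.supValue u :=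
  (le_ciSup (f := fun K : M.Cell => u (.inl (.inl K))) (finite_range _).bddAbove K).trans
    (le_max_left _ _)

lemma le_supValue_vertex (u : M.Index → ℝ) (a : M.Vertex) : u (.inr a) ≤ M.supValue u :=
  (le_ciSup (f := fun a : M.Vertex => u (.inr a)) (finite_range _).bddAbove a).trans
    (le_max_right _ _)

end MeshData

end DDFV

end

theorem proposition5p3 (Ω : Set DDFV.Plane) (hΩ : DDFV.IsPolygonalDomain Ω)
    (Θ : ℝ) (hΘ : 1 ≤ Θ) :
    ∃ C : ℝ, 0 < C ∧
      ∀ M : DDFV.MeshData, M.IsMesh Ω → M.IsRegular Ω Θ →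
      ∀ (v vinf : M.Index → ℝ) (M₁ Minf : ℝ),
        (∀ K : M.Cell, 0 < v (.inl (.inl K)) ∧ 0 < vinf (.inl (.inl K))) →
        (∀ a : M.Vertex, 0 < v (.inr a) ∧ 0 < vinf (.inr a)) →
        M.primalMass v = M₁ → M.primalMass vinf = M₁ →
        M.dualMass v = M₁ → M.dualMass vinf = M₁ →
        Minf = M.supValue vinf →
        M.pairing (fun i => v i * Real.log (v i / vinf i)) (fun _ => 1) ≤
          C * (M₁ * Minf) ^ (1 / 2 : ℝ) *
            ∑ σ : M.Edge, M.mDiamond σ * ‖M.grad (fun i => √(v i / vinf i)) σ‖ ^ 2 := by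
  have hΘ0 : 0 ≤ Θ := by linarith
  obtain ⟨K, hK0, hK⟩ := hΩ.exists_sobolev (κ := 8 * Θ) (by positivity)
  refine ⟨24 * K + 1, by positivity, ?_⟩
  intro M hM hreg v vinf M₁ Minf hcell hvtx hp hp' hd hd' hMinf
  set g : M.Index → ℝ := fun i => √(v i / vinf i) with hg
  set T := ∑ σ : M.Edge, M.mDiamond σ * ‖M.grad g σ‖ ^ 2 with hT
  have hterm : ∀ σ, 0 ≤ M.mDiamond σ * ‖M.grad g σ‖ ^ 2 := fun σ =>
    mul_nonneg measureReal_nonneg (sq_nonneg _)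
  have hT0 : 0 ≤ T := Finset.sum_nonneg fun σ _ => hterm σ
  have hMinf0 : 0 ≤ Minf := by
    rw [hMinf]
    exact (Real.iSup_nonneg fun K => (hcell K).2.le).trans (le_max_left _ _)
  have hdisj : Pairwise (Function.onFun Disjoint M.diamond) := fun σ σ' h =>
    hM.diamond_partition.disjoint σ σ' h
  have hdiam := fun σ => hM.lengths_le_diam hΩ.isBounded σ
  have hprimal : ∑ K, M.mCell K * (v (.inl (.inl K)) * Real.log (v (.inl (.inl K)) /
      vinf (.inl (.inl K)))) ≤ 24 * √(M₁ * Minf) * (K * T) := by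
    obtain ⟨c, hc, hcX⟩ := hK (D := fun e => M.diamond (.inl e))
      (dlen := fun e => M.mDualEdge (.inl e)) (G := fun e => ‖M.grad g (.inl e)‖)
      (g := fun K => g (.inl (.inl K))) hM.isInterface_primal
      (fun e => hM.diamond_partition.subset _) (fun e e' h => hdisj (Sum.inl_injective.ne h))
      (hM.exists_piece_primal hΘ0 hreg) (fun e => dist_nonneg) (fun e => (hdiam _).2)
      (fun K => Real.sqrt_nonneg _)
      (fun e => by
        have := hM.abs_primal_sub_le g (.inl e)
        rw [abs_sub_comm] at this
        exact this)
    have hsum : ∑ e : M.IntEdge, volume.real (M.diamond (.inl e)) * ‖M.grad g (.inl e)‖ ^ 2 ≤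
        T := by
      rw [hT, Fintype.sum_sum_type]
      exact le_add_of_nonneg_right (Finset.sum_nonneg fun e _ => hterm _)
    refine (DDFV.sum_mul_log_le (M := M₁) (W := Minf) (c := c) (fun K => measureReal_nonneg)
      (fun K => (hcell K).1) (fun K => (hcell K).2)
      (fun K => hMinf ▸ DDFV.MeshData.le_supValue_cell vinf K) hp hp' hMinf0 hc).trans ?_
    exact mul_le_mul_of_nonneg_left (hcX.trans (mul_le_mul_of_nonneg_left hsum hK0))
      (by positivity)
  have hdual : ∑ a, M.mDual a * (v (.inr a) * Real.log (v (.inr a) / vinf (.inr a))) ≤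
      24 * √(M₁ * Minf) * (K * T) := by
    obtain ⟨c, hc, hcX⟩ := hK (D := M.diamond)
      (dlen := M.mEdge) (G := fun σ => ‖M.grad g σ‖)
      (g := fun a => g (.inr a)) (hM.isInterface_dual hΩ.isOpen)
      hM.diamond_partition.subset hdisj
      (hM.exists_piece_dual hΘ0 hreg) (fun e => dist_nonneg) (fun e => (hdiam _).1)
      (fun K => Real.sqrt_nonneg _)
      (fun σ => by
        have := hM.abs_dual_sub_le g σ
        rw [abs_sub_comm] at this
        exact this)
    refine (DDFV.sum_mul_log_le (M := M₁) (W := Minf) (c := c) (fun a => measureReal_nonneg)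
      (fun a => (hvtx a).1) (fun a => (hvtx a).2)
      (fun a => hMinf ▸ DDFV.MeshData.le_supValue_vertex vinf a) hd hd' hMinf0 hc).trans ?_
    exact mul_le_mul_of_nonneg_left hcX (by positivity)
  rw [← Real.sqrt_eq_rpow, DDFV.MeshData.pairing]
  simp only [mul_one]
  have h0 : 0 ≤ √(M₁ * Minf) * T := by positivity
  nlinarith
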